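/- Let $A(2,n,k)$ ($0\le k\le n$) be the d'Arcais numbers, defined by the formal power series identity $$\sum_{n\ge 0}\sum_{k=0}^{n}\frac{A(2,n,k)}{n!}\,x^k z^n=\prod_{d\ge 1}(1-z^d)^{-x},$$ with $A(2,n,k)=0$ for $k>n$, and let $\alpha(n,k)=k!\,A(2,n,k)/n!$. Then $\alpha(n,k)>0$ for $1\le k\le n$ (so the quotients below are defined for $n\ge k+1$), and the following hold. (1) For $k=2$, $$\liminf_{n\to\infty}\frac{\alpha(n,2)^2}{\alpha(n,1)\,\alpha(n,3)}=0,$$ and the Heim–Neuhauser inequality $$\frac{A(2,n,k)}{A(2,n,k-1)}\ \ge\ \frac{A(2,n,k+1)}{A(2,n,k)}$$ (conjectured for all $k\ge 2$ and all $n$) fails at $k=2$ for infinitely many $n$. (2) For every integer $k\ge 3$, $$\liminf_{n\to\infty}\frac{\alpha(n,k)^2}{\alpha(n,k-1)\,\alpha(n,k+1)}=\frac{k}{k-1}\cdot\frac{\zeta(2k+2)\,\zeta(2k-2)}{\zeta(2k)^2}\cdot\frac{\zeta(2k-1)^2}{\zeta(2k-3)\,\zeta(2k+1)}>1,$$ and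 there is $N=N(k)$ such that the Heim–Neuhauser inequality holds at $k$ for all $n\ge N$. -/

import Mathlib

open Filter
open scoped Polynomial Nat

noncomputable section

/-- The formal power series in `z` with coefficients in `ℝ[x]`
`(1 - z ^ d) ^ (-x) = ∑_j x (x + 1) ⋯ (x + j - 1) / j! * z ^ (d j)`, for `d ≥ 1`. -/
def oneSubPowNegX (d : ℕ) : PowerSeries ℝ[X] :=
  PowerSeries.mk fun m =>
    if d ∣ m then Polynomial.C (((m / d)! : ℝ)⁻¹) * ascPochhammer ℝ (m / d) else 0

/-- The formal power series in `z` with coefficients in `ℝ[x]`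
`((z; z)_∞) ^ (-x) = ∏_{d ≥ 1} (1 - z ^ d) ^ (-x)`. The factors with `d > n` do not affect
the coefficient of `z ^ n`, see `coeff_prod_oneSubPowNegX`. -/
def qPochhammerNegPow : PowerSeries ℝ[X] :=
  PowerSeries.mk fun n => PowerSeries.coeff n (∏ d ∈ Finset.Icc 1 n, oneSubPowNegX d)

/-- The coefficient of `z ^ n` in the partial product over `1 ≤ d ≤ N` is constant for `N ≥ n`,
so that `qPochhammerNegPow` is the infinite product. -/
theorem coeff_prod_oneSubPowNegX {n N : ℕ} (h : n ≤ N) :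
    PowerSeries.coeff n (∏ d ∈ Finset.Icc 1 N, oneSubPowNegX d) =
      PowerSeries.coeff n qPochhammerNegPow := by
  induction N, h using Nat.le_induction with
  | base => simp [qPochhammerNegPow]
  | succ N hN ih =>
    rw [← ih, Finset.prod_Icc_succ_top (by omega), PowerSeries.coeff_mul,
      Finset.sum_eq_single (n, 0)]
    · simp [oneSubPowNegX]
    · rintro ⟨a, b⟩ hab hne
      replace hab := Finset.HasAntidiagonal.mem_antidiagonal.mp hab
      have hb : b ≠ 0 := by
        rintro rfl
        exact hne (by simpa using hab)
      have hd : ¬ (N + 1 ∣ b) := fun hdvd => by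
        have h1 := Nat.le_of_dvd (Nat.pos_of_ne_zero hb) hdvd
        simp only at hab
        omega
      simp [oneSubPowNegX, hd]
    · intro h0
      simp at h0

/-- The d'Arcais numbers `A(2, n, k)`, defined by
`∑_{n, k} A(2, n, k) / n! * x ^ k * z ^ n = ((z; z)_∞) ^ (-x)`. -/
def dArcais (n k : ℕ) : ℝ :=
  (n ! : ℝ) * (PowerSeries.coeff n qPochhammerNegPow).coeff k

/-- `α(n, k) = k! A(2, n, k) / n!`. -/
def dArcaisAlpha (n k : ℕ) : ℝ :=
  (k ! : ℝ) * dArcais n k / (n ! : ℝ)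

/-- The inequality conjectured by Heim and Neuhauser (for all `k ≥ 2` and all `n`):
`A(2, n, k) / A(2, n, k - 1) ≥ A(2, n, k + 1) / A(2, n, k)`. -/
def HeimNeuhauser (n k : ℕ) : Prop :=
  dArcais n k / dArcais n (k - 1) ≥ dArcais n (k + 1) / dArcais n k

/-- The Riemann zeta function at a real argument (where its value is real). -/
def zetaReal (s : ℝ) : ℝ := (riemannZeta (s : ℂ)).re

/-- The value of the limit inferior for `k ≥ 3`. -/
def alphaLimit (k : ℕ) : ℝ :=
  (k : ℝ) / ((k : ℝ) - 1)
    * (zetaReal (2 * k + 2) * zetaReal (2 * k - 2) / zetaReal (2 * k) ^ 2)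
    * (zetaReal (2 * k - 1) ^ 2 / (zetaReal (2 * k - 3) * zetaReal (2 * k + 1)))

end

/-! Write σ_{-m}(n) for the sum of d^(-m) over d ∣ n. Differentiating the product in x multiplies it
by -∑ log(1 - z^d) = ∑ σ_{-1}(n) z^n, so α(·, k) is the k-fold additive convolution of σ_{-1}
(`dArcaisAlpha_succ`).

Convolving σ_{-1} with b^j σ_{-m}(b) amounts to summing b^j over e ∣ b, d ∣ n - b. These b have
density 1/lcm(d, e) if gcd(d, e) ∣ n and 0 otherwise; summing over d and e with dominated
convergence gives a constant times n^(j+1) σ_{-(m+2)}(n), up to o(n^(j+1)). By induction α(n, j+1) =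
n^j (c_j σ_{-(2j+1)}(n) + o(1)) with explicit c_j (`tendsto_dArcaisAlpha`).

Hence the quotient at k is asymptotically a constant times σ_{-(2k-1)}(n)² / (σ_{-(2k-3)}(n)
σ_{-(2k+1)}(n)). For k = 2 the factor σ_{-1} is unbounded along n = N! while the other factors stay
between positive constants, so the liminf is 0. For k ≥ 3 the Euler product of ζ(m)/σ_{-m}(n),
compared prime by prime, bounds this ratio below by the same expression in zeta values
(`le_sigmaNegQuotient`), and n = N! attains the bound in the limit.

In terms of α the Heim–Neuhauser inequality says that the quotient is at least k/(k+1) < 1. It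
therefore fails when the quotient is near 0, and holds eventually when the liminf exceeds 1. -/

/-! ### The derivative in `x` and the convolution recursion -/

/-- Coefficientwise derivative in `x` of a power series in `z` over `ℝ[x]`. -/
noncomputable def coeffDeriv (F : PowerSeries ℝ[X]) : PowerSeries ℝ[X] :=
  PowerSeries.mk fun n => Polynomial.derivative (PowerSeries.coeff n F)

theorem coeffDeriv_mul (F G : PowerSeries ℝ[X]) :
    coeffDeriv (F * G) = coeffDeriv F * G + F * coeffDeriv G := by
  ext1 n
  simp only [coeffDeriv, PowerSeries.coeff_mk, PowerSeries.coeff_mul, map_add,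
    Polynomial.derivative_sum, Polynomial.derivative_mul, Finset.sum_add_distrib]

theorem coeffDeriv_one : coeffDeriv 1 = 0 := by
  ext1 n
  simp only [coeffDeriv, PowerSeries.coeff_mk, PowerSeries.coeff_one]
  split_ifs <;> simp

/-- The power series `-log (1 - z ^ d)`. -/
noncomputable def negLogOneSubPow (d : ℕ) : PowerSeries ℝ[X] :=
  PowerSeries.mk fun m => if d ∣ m then Polynomial.C ((d : ℝ) / m) else 0

/-- The rising factorial polynomial `x (x + 1) ⋯ (x + j - 1) / j!`. -/
noncomputable def risingBinom (j : ℕ) : ℝ[X] := Polynomial.C ((j ! : ℝ)⁻¹) * ascPochhammer ℝ j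

theorem succ_mul_risingBinom (j : ℕ) :
    ((j : ℝ[X]) + 1) * risingBinom (j + 1) = (Polynomial.X + (j : ℝ[X])) * risingBinom j := by
  have h : ((j : ℝ[X]) + 1) = Polynomial.C ((j : ℝ) + 1) := by simp
  have h2 : Polynomial.C ((j : ℝ) + 1) * Polynomial.C (((j + 1) ! : ℝ)⁻¹) =
      Polynomial.C ((j ! : ℝ)⁻¹) := by
    rw [← Polynomial.C_mul]
    congr 1
    rw [Nat.factorial_succ]
    push_cast
    have : (j ! : ℝ) ≠ 0 := by positivity
    field_simp
  rw [risingBinom, h, ← mul_assoc, h2, risingBinom, ascPochhammer_succ_right]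
  ring

/-- Coefficient form of d/dx (1 - z)^(-x) = -log(1 - z) · (1 - z)^(-x), obtained by induction from
the two-term recursion `succ_mul_risingBinom`. -/
theorem derivative_risingBinom (j : ℕ) :
    Polynomial.derivative (risingBinom j) =
      ∑ i ∈ Finset.range j, Polynomial.C (((j - i : ℕ) : ℝ)⁻¹) * risingBinom i := by
  induction j with
  | zero => simp [risingBinom]
  | succ j ih =>
    have hne : ((j : ℝ[X]) + 1) ≠ 0 := by exact_mod_cast Nat.succ_ne_zero j
    apply mul_left_cancel₀ hne
    have h1 : ((j : ℝ[X]) + 1) * Polynomial.derivative (risingBinom (j + 1)) =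
        risingBinom j + (Polynomial.X + (j : ℝ[X])) * Polynomial.derivative (risingBinom j) := by
      have := congrArg Polynomial.derivative (succ_mul_risingBinom j)
      simpa [Polynomial.derivative_mul] using this
    rw [h1, ih]
    -- Splitting j + 1 = (j + 1 - i) + i cancels the reciprocal in the first part. The second part,
    -- shifted by one in i, is matched with the induction hypothesis in `key2`.
    have key : ∀ i ∈ Finset.range (j + 1), ((j : ℝ[X]) + 1) *
        (Polynomial.C (((j + 1 - i : ℕ) : ℝ)⁻¹) * risingBinom i) =
        risingBinom i + Polynomial.C (((j + 1 - i : ℕ) : ℝ)⁻¹) * ((i : ℝ[X]) * risingBinom i) := by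
      intro i hi
      have hi' : i ≤ j := by simpa [Nat.lt_succ_iff] using hi
      have e1 : ((j : ℝ[X]) + 1) = Polynomial.C (((j + 1 - i : ℕ) : ℝ)) + (i : ℝ[X]) := by
        rw [Nat.cast_sub (by omega)]
        simp
      have hc : (((j + 1 - i : ℕ) : ℝ)) ≠ 0 := by
        have : j + 1 - i ≠ 0 := by omega
        exact_mod_cast this
      have e2 : Polynomial.C (((j + 1 - i : ℕ) : ℝ)) * Polynomial.C (((j + 1 - i : ℕ) : ℝ)⁻¹) =
          1 := by
        rw [← Polynomial.C_mul, mul_inv_cancel₀ hc, Polynomial.C_1]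
      rw [e1]
      linear_combination (risingBinom i) * e2
    rw [Finset.mul_sum, Finset.mul_sum (Finset.range (j + 1)), Finset.sum_congr rfl key, Finset.sum_add_distrib,
      Finset.sum_range_succ, Finset.sum_range_succ' (fun i => Polynomial.C _ * _)]
    have key2 : ∀ i ∈ Finset.range j, Polynomial.C (((j + 1 - (i + 1) : ℕ) : ℝ)⁻¹) *
        (((i + 1 : ℕ) : ℝ[X]) * risingBinom (i + 1)) =
        (Polynomial.X + (j : ℝ[X])) * (Polynomial.C (((j - i : ℕ) : ℝ)⁻¹) * risingBinom i) -
          risingBinom i := by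
      intro i hi
      have hi' : i < j := by simpa using hi
      have e0 := succ_mul_risingBinom i
      have e1 : (j : ℝ[X]) = Polynomial.C (((j - i : ℕ) : ℝ)) + (i : ℝ[X]) := by
        rw [Nat.cast_sub (by omega)]
        simp
      have hc : (((j - i : ℕ) : ℝ)) ≠ 0 := by
        have : j - i ≠ 0 := by omega
        exact_mod_cast this
      have e2 : Polynomial.C (((j - i : ℕ) : ℝ)) * Polynomial.C (((j - i : ℕ) : ℝ)⁻¹) =
          1 := by
        rw [← Polynomial.C_mul, mul_inv_cancel₀ hc, Polynomial.C_1]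
      rw [Nat.add_sub_add_right, e1]
      push_cast
      linear_combination Polynomial.C (((j - i : ℕ) : ℝ)⁻¹) * e0 - (risingBinom i) * e2
    rw [Finset.sum_congr rfl key2, Finset.sum_sub_distrib, ← Finset.mul_sum]
    simp
    ring

theorem coeff_oneSubPowNegX_mul {d : ℕ} (hd : 0 < d) (j : ℕ) :
    PowerSeries.coeff (d * j) (oneSubPowNegX d) = risingBinom j := by
  simp [oneSubPowNegX, risingBinom, Nat.mul_div_cancel_left j hd]

theorem coeffDeriv_oneSubPowNegX {d : ℕ} (hd : 0 < d) :
    coeffDeriv (oneSubPowNegX d) = negLogOneSubPow d * oneSubPowNegX d := by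
  ext1 n
  rw [coeffDeriv, PowerSeries.coeff_mk, PowerSeries.coeff_mul]
  by_cases hn : d ∣ n
  · obtain ⟨j, rfl⟩ := hn
    rw [coeff_oneSubPowNegX_mul hd, derivative_risingBinom]
    -- Only pairs of multiples of d contribute. The pair (0, d j) is left out because the logarithm
    -- has no constant term: d / 0 = 0.
    have hinj : Set.InjOn (fun i => (d * (j - i), d * i)) (Finset.range j : Set ℕ) := by
      intro a _ b _ hab
      simpa [hd.ne'] using congrArg Prod.snd hab
    rw [← Finset.sum_subset (s₁ := (Finset.range j).image fun i => (d * (j - i), d * i)),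
      Finset.sum_image hinj]
    · refine Finset.sum_congr rfl fun i hi => ?_
      have hi' : i < j := by simpa using hi
      rw [coeff_oneSubPowNegX_mul hd, negLogOneSubPow, PowerSeries.coeff_mk,
        if_pos (dvd_mul_right _ _)]
      congr 2
      have : (d : ℝ) ≠ 0 := by positivity
      push_cast
      rw [div_mul_eq_div_div, div_self this, one_div]
    · intro p hp
      simp only [Finset.mem_image, Finset.mem_range] at hp
      obtain ⟨i, hi, rfl⟩ := hp
      rw [Finset.HasAntidiagonal.mem_antidiagonal, ← mul_add, Nat.sub_add_cancel hi.le]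
    · rintro ⟨a, b⟩ hab hnot
      rw [Finset.HasAntidiagonal.mem_antidiagonal] at hab
      simp only [negLogOneSubPow, oneSubPowNegX, PowerSeries.coeff_mk]
      by_cases ha : d ∣ a
      · by_cases hb : d ∣ b
        · obtain ⟨a, rfl⟩ := ha
          obtain ⟨b, rfl⟩ := hb
          have hj : a + b = j := by
            simp only [← mul_add] at hab
            exact Nat.eq_of_mul_eq_mul_left hd hab
          by_cases ha0 : a = 0
          · simp [ha0]
          · exfalso
            apply hnot
            simp only [Finset.mem_image, Finset.mem_range]
            exact ⟨b, by omega, by rw [← hj, Nat.add_sub_cancel]⟩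
        · simp [hb]
      · simp [ha]
  · have h1 : PowerSeries.coeff n (oneSubPowNegX d) = 0 := by simp [oneSubPowNegX, hn]
    rw [h1, Polynomial.derivative_zero]
    symm
    apply Finset.sum_eq_zero
    rintro ⟨a, b⟩ hab
    rw [Finset.HasAntidiagonal.mem_antidiagonal] at hab
    simp only [negLogOneSubPow, oneSubPowNegX, PowerSeries.coeff_mk]
    by_cases ha : d ∣ a
    · have hb : ¬ d ∣ b := fun hb => hn (hab ▸ dvd_add ha hb)
      simp [hb]
    · simp [ha]

theorem coeffDeriv_prod (N : ℕ) :
    coeffDeriv (∏ d ∈ Finset.Icc 1 N, oneSubPowNegX d) =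
      (∑ d ∈ Finset.Icc 1 N, negLogOneSubPow d) * ∏ d ∈ Finset.Icc 1 N, oneSubPowNegX d := by
  induction N with
  | zero => simp [coeffDeriv_one]
  | succ N ih =>
    rw [Finset.prod_Icc_succ_top (by omega), Finset.sum_Icc_succ_top (by omega), coeffDeriv_mul,
      ih, coeffDeriv_oneSubPowNegX (by omega)]
    ring

/-- `sigmaNeg m n = ∑_{d ∣ n} d ^ (-m)`. -/
noncomputable def sigmaNeg (m n : ℕ) : ℝ := ∑ d ∈ n.divisors, 1 / (d : ℝ) ^ m

theorem coeff_sum_negLogOneSubPow {n N : ℕ} (h : n ≤ N) :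
    PowerSeries.coeff n (∑ d ∈ Finset.Icc 1 N, negLogOneSubPow d) =
      Polynomial.C (sigmaNeg 1 n) := by
  simp only [map_sum, negLogOneSubPow, PowerSeries.coeff_mk]
  rw [← Finset.sum_filter]
  rcases Nat.eq_zero_or_pos n with rfl | hn
  · simp [sigmaNeg]
  · have : (Finset.Icc 1 N).filter (fun d => d ∣ n) = n.divisors := by
      ext d
      simp only [Finset.mem_filter, Finset.mem_Icc, Nat.mem_divisors]
      constructor
      · rintro ⟨_, h2⟩
        exact ⟨h2, hn.ne'⟩
      · rintro ⟨h1, _⟩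
        have := Nat.le_of_dvd hn h1
        have := Nat.pos_of_dvd_of_pos h1 hn
        exact ⟨by omega, h1⟩
    -- The coefficient is the sum of d / n over d ∣ n; passing to complementary divisors turns it
    -- into σ_{-1}(n).
    rw [this, ← map_sum, sigmaNeg, ← Nat.sum_div_divisors n (fun d => 1 / (d : ℝ) ^ 1)]
    congr 1
    refine Finset.sum_congr rfl fun d hd => ?_
    have hd' := Nat.dvd_of_mem_divisors hd
    have hd0 : (d : ℝ) ≠ 0 := by
      have := Nat.pos_of_mem_divisors hd
      positivity
    rw [Nat.cast_div hd' hd0]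
    simp

theorem derivative_coeff_qPochhammerNegPow (n : ℕ) :
    Polynomial.derivative (PowerSeries.coeff n qPochhammerNegPow) =
      ∑ p ∈ Finset.HasAntidiagonal.antidiagonal n, Polynomial.C (sigmaNeg 1 p.1) *
        PowerSeries.coeff p.2 qPochhammerNegPow := by
  have h := congrArg (PowerSeries.coeff n) (coeffDeriv_prod n)
  rw [coeffDeriv, PowerSeries.coeff_mk, coeff_prod_oneSubPowNegX le_rfl,
    PowerSeries.coeff_mul] at h
  rw [h]
  refine Finset.sum_congr rfl fun p hp => ?_
  rw [Finset.HasAntidiagonal.mem_antidiagonal] at hp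
  rw [coeff_sum_negLogOneSubPow (by omega), coeff_prod_oneSubPowNegX (by omega)]

theorem dArcaisAlpha_eq (n k : ℕ) :
    dArcaisAlpha n k = (k ! : ℝ) * (PowerSeries.coeff n qPochhammerNegPow).coeff k := by
  have : (n ! : ℝ) ≠ 0 := by positivity
  rw [dArcaisAlpha, dArcais]
  field_simp

/-- Differentiation brings down a factor k + 1, which the normalisation by k! absorbs, leaving a
plain convolution. -/
theorem dArcaisAlpha_succ (n k : ℕ) :
    dArcaisAlpha n (k + 1) =
      ∑ p ∈ Finset.HasAntidiagonal.antidiagonal n, sigmaNeg 1 p.1 * dArcaisAlpha p.2 k := by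
  have h := congrArg (fun P => Polynomial.coeff P k) (derivative_coeff_qPochhammerNegPow n)
  simp only [Polynomial.coeff_derivative, Polynomial.finsetSum_coeff, Polynomial.coeff_C_mul] at h
  simp only [dArcaisAlpha_eq]
  rw [Nat.factorial_succ]
  push_cast
  calc _ = (k ! : ℝ) * ((PowerSeries.coeff n qPochhammerNegPow).coeff (k + 1) * (k + 1)) := by ring
    _ = _ := by
      rw [h, Finset.mul_sum]
      exact Finset.sum_congr rfl fun p _ => by ring

theorem dArcaisAlpha_zero_right (n : ℕ) : dArcaisAlpha n 0 = if n = 0 then 1 else 0 := by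
  -- At x = 0 every factor of the product is 1.
  have h1 : ∀ d, 0 < d → PowerSeries.map (Polynomial.evalRingHom (0 : ℝ)) (oneSubPowNegX d) = 1 := by
    intro d hd
    ext n
    rw [PowerSeries.coeff_map, oneSubPowNegX, PowerSeries.coeff_mk, PowerSeries.coeff_one]
    split_ifs with h2 h3 h3
    · simp [h3]
    · have : n / d ≠ 0 := by
        obtain ⟨j, rfl⟩ := h2
        rw [Nat.mul_div_cancel_left j hd]
        rintro rfl
        simp at h3
      simp [ascPochhammer_ne_zero_eval_zero, this]
    · simp [h3] at h2
    · simp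
  have h2 : PowerSeries.map (Polynomial.evalRingHom (0 : ℝ))
      (∏ d ∈ Finset.Icc 1 n, oneSubPowNegX d) = 1 := by
    rw [map_prod]
    exact Finset.prod_eq_one fun d hd => h1 d (by simp at hd; omega)
  have h3 := congrArg (PowerSeries.coeff n) h2
  rw [PowerSeries.coeff_map, coeff_prod_oneSubPowNegX le_rfl, PowerSeries.coeff_one] at h3
  rw [dArcaisAlpha_eq, Polynomial.coeff_zero_eq_eval_zero]
  simpa using h3

/-! ### Positivity and boundary values -/

theorem sigmaNeg_nonneg (m n : ℕ) : 0 ≤ sigmaNeg m n :=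
  Finset.sum_nonneg fun _ _ => by positivity

theorem one_le_sigmaNeg (m : ℕ) {n : ℕ} (hn : n ≠ 0) : 1 ≤ sigmaNeg m n := by
  have := Finset.single_le_sum (f := fun d : ℕ => 1 / (d : ℝ) ^ m) (s := n.divisors)
    (fun _ _ => by positivity) (Nat.one_mem_divisors.2 hn)
  simpa [sigmaNeg] using this

@[simp] theorem sigmaNeg_zero_right (m : ℕ) : sigmaNeg m 0 = 0 := by simp [sigmaNeg]

theorem dArcaisAlpha_one (n : ℕ) : dArcaisAlpha n 1 = sigmaNeg 1 n := by
  rw [dArcaisAlpha_succ, Finset.sum_eq_single (n, 0)]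
  · simp [dArcaisAlpha_zero_right]
  · rintro ⟨a, b⟩ hab hne
    have : b ≠ 0 := by
      rintro rfl
      exact hne (by simpa using hab)
    simp [dArcaisAlpha_zero_right, this]
  · simp

theorem dArcaisAlpha_nonneg (n k : ℕ) : 0 ≤ dArcaisAlpha n k := by
  induction k generalizing n with
  | zero =>
    rw [dArcaisAlpha_zero_right]
    split_ifs <;> norm_num
  | succ k ih =>
    rw [dArcaisAlpha_succ]
    exact Finset.sum_nonneg fun p _ => mul_nonneg (sigmaNeg_nonneg _ _) (ih _)

theorem dArcaisAlpha_pos {n k : ℕ} (hk : 1 ≤ k) (hkn : k ≤ n) : 0 < dArcaisAlpha n k := by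
  induction k, hk using Nat.le_induction generalizing n with
  | base =>
    rw [dArcaisAlpha_one]
    exact lt_of_lt_of_le one_pos (one_le_sigmaNeg 1 (by omega))
  | succ k hk ih =>
    rw [dArcaisAlpha_succ]
    have h1 : (1, n - 1) ∈ Finset.HasAntidiagonal.antidiagonal n := by
      rw [Finset.HasAntidiagonal.mem_antidiagonal]; omega
    refine lt_of_lt_of_le ?_ (Finset.single_le_sum
      (fun p _ => mul_nonneg (sigmaNeg_nonneg _ _) (dArcaisAlpha_nonneg _ _)) h1)
    exact mul_pos (lt_of_lt_of_le one_pos (one_le_sigmaNeg 1 one_ne_zero)) (ih (by omega))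

theorem dArcaisAlpha_zero_left {k : ℕ} (hk : 1 ≤ k) : dArcaisAlpha 0 k = 0 := by
  obtain ⟨k, rfl⟩ := Nat.exists_eq_add_of_le' hk
  simp [dArcaisAlpha_succ]

/-! ### Power sums over arithmetic progressions -/

theorem pow_succ_sub_pow_succ_bounds {x y : ℝ} (hy : 0 ≤ y) (hxy : y ≤ x) (k : ℕ) :
    (k + 1) * y ^ k * (x - y) ≤ x ^ (k + 1) - y ^ (k + 1) ∧
      x ^ (k + 1) - y ^ (k + 1) ≤ (k + 1) * x ^ k * (x - y) := by
  have hx : 0 ≤ x := hy.trans hxy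
  have h := (Commute.all x y).geom_sum₂_mul (k + 1)
  rw [← h]
  have hd : 0 ≤ x - y := sub_nonneg.2 hxy
  have hsplit : ∀ z : ℝ, ∑ i ∈ Finset.range (k + 1), z ^ i * z ^ (k + 1 - 1 - i) =
      (k + 1) * z ^ k := by
    intro z
    rw [Finset.sum_congr rfl (g := fun _ => z ^ k)]
    · simp
    · intro i hi
      rw [← pow_add]
      congr 1
      simp at hi
      omega
  constructor
  · rw [← hsplit]
    gcongr
  · rw [← hsplit]
    gcongr

theorem card_filter_Ico_modEq {l : ℕ} (hl : 0 < l) (r n : ℕ) :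
    ((Finset.Ico n (n + l)).filter (fun b => b ≡ r [MOD l])).card = 1 := by
  rw [Nat.filter_Ico_card_eq_of_periodic]
  · rw [Nat.count_modEq_card _ hl]
    have : r % l < l := Nat.mod_lt _ hl
    simp [Nat.div_self hl, Nat.mod_self]
  · intro b
    simp [Nat.ModEq]

/-- Each block [m, m + l) contains exactly one b in the class. Both b^k and the increment of n^(k+1)
/ ((k+1) l) over the block lie in [m^k, (m+l)^k], so the error telescopes; the induction descends by
l. -/
theorem abs_sum_pow_modEq_sub_le {l : ℕ} (hl : 0 < l) (r k : ℕ) {n : ℕ} (hn : 1 ≤ n) :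
    |∑ b ∈ (Finset.Ico 1 n).filter (fun b => b ≡ r [MOD l]), (b : ℝ) ^ k -
      (n : ℝ) ^ (k + 1) / ((k + 1) * l)| ≤ (l : ℝ) ^ k + (n : ℝ) ^ k := by
  have hl' : (0 : ℝ) < l := by exact_mod_cast hl
  induction n using Nat.strong_induction_on with
  | _ n ih =>
    rcases le_or_gt n l with h | h
    · have h1 : 0 ≤ ∑ b ∈ (Finset.Ico 1 n).filter (fun b => b ≡ r [MOD l]), (b : ℝ) ^ k :=
        Finset.sum_nonneg fun _ _ => by positivity
      have h2 : ∑ b ∈ (Finset.Ico 1 n).filter (fun b => b ≡ r [MOD l]), (b : ℝ) ^ k ≤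
          (l : ℝ) ^ k := by
        have hc : ((Finset.Ico 1 n).filter (fun b => b ≡ r [MOD l])).card ≤ 1 :=
          (Finset.card_le_card (Finset.filter_subset_filter _
            (Finset.Ico_subset_Ico le_rfl (by omega : n ≤ 1 + l)))).trans_eq
              (card_filter_Ico_modEq hl r 1)
        calc _ ≤ ∑ b ∈ (Finset.Ico 1 n).filter (fun b => b ≡ r [MOD l]), (l : ℝ) ^ k := by
              refine Finset.sum_le_sum fun b hb => ?_
              simp only [Finset.mem_filter, Finset.mem_Ico] at hb
              have : (b : ℝ) ≤ l := by exact_mod_cast (by omega : b ≤ l)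
              gcongr
          _ ≤ _ := by
              rw [Finset.sum_const, nsmul_eq_mul]
              have : (((Finset.Ico 1 n).filter (fun b => b ≡ r [MOD l])).card : ℝ) ≤ 1 := by
                exact_mod_cast hc
              exact mul_le_of_le_one_left (by positivity) this
      have h3 : 0 ≤ (n : ℝ) ^ (k + 1) / ((k + 1) * l) := by positivity
      have h4 : (n : ℝ) ^ (k + 1) / ((k + 1) * l) ≤ (n : ℝ) ^ k := by
        rw [div_le_iff₀ (by positivity), pow_succ]
        have : (n : ℝ) ≤ l := by exact_mod_cast h
        have : (n : ℝ) ≤ (k + 1) * l := by nlinarith [(Nat.cast_nonneg k : (0 : ℝ) ≤ k)]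
        gcongr
      have h5 : (0 : ℝ) ≤ (n : ℝ) ^ k := by positivity
      have h6 : (0 : ℝ) ≤ (l : ℝ) ^ k := by positivity
      rw [abs_le]
      constructor <;> linarith
    · obtain ⟨m, rfl⟩ : ∃ m, n = m + l := ⟨n - l, by omega⟩
      have hm : 1 ≤ m := by omega
      have IH := ih m (by omega) hm
      have hsplit : ∑ b ∈ (Finset.Ico 1 (m + l)).filter (fun b => b ≡ r [MOD l]), (b : ℝ) ^ k =
          ∑ b ∈ (Finset.Ico 1 m).filter (fun b => b ≡ r [MOD l]), (b : ℝ) ^ k +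
          ∑ b ∈ (Finset.Ico m (m + l)).filter (fun b => b ≡ r [MOD l]), (b : ℝ) ^ k := by
        simp only [Finset.sum_filter]
        rw [Finset.sum_Ico_consecutive _ hm (by omega)]
      obtain ⟨c, hc⟩ := Finset.card_eq_one.1 (card_filter_Ico_modEq hl r m)
      have hcm : c ∈ (Finset.Ico m (m + l)).filter (fun b => b ≡ r [MOD l]) := by simp [hc]
      simp only [Finset.mem_filter, Finset.mem_Ico] at hcm
      rw [hsplit, hc, Finset.sum_singleton]
      have hb := pow_succ_sub_pow_succ_bounds (x := (m : ℝ) + l) (y := m) (by positivity)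
        (by linarith) k
      rw [add_sub_cancel_left] at hb
      have c1 : (m : ℝ) ^ k ≤ (c : ℝ) ^ k := by
        have : (m : ℝ) ≤ c := by exact_mod_cast hcm.1.1
        gcongr
      have c2 : (c : ℝ) ^ k ≤ ((m : ℝ) + l) ^ k := by
        have : (c : ℝ) ≤ m + l := by exact_mod_cast hcm.1.2.le
        gcongr
      have d1 : (m : ℝ) ^ k ≤ (((m : ℝ) + l) ^ (k + 1) - (m : ℝ) ^ (k + 1)) / ((k + 1) * l) := by
        rw [le_div_iff₀ (by positivity)]
        linarith [hb.1]
      have d2 : (((m : ℝ) + l) ^ (k + 1) - (m : ℝ) ^ (k + 1)) / ((k + 1) * l) ≤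
          ((m : ℝ) + l) ^ k := by
        rw [div_le_iff₀ (by positivity)]
        linarith [hb.2]
      rw [sub_div] at d1 d2
      push_cast
      rw [abs_le] at IH ⊢
      constructor <;> linarith [IH.1, IH.2]

/-- The sum of `b ^ k` over `0 < b < n` with `e ∣ b` and `d ∣ n - b`. -/
noncomputable def progressionSum (k d e n : ℕ) : ℝ :=
  ∑ b ∈ (Finset.Ico 1 n).filter (fun b => e ∣ b ∧ d ∣ n - b), (b : ℝ) ^ k

theorem progressionSum_nonneg (k d e n : ℕ) : 0 ≤ progressionSum k d e n :=
  Finset.sum_nonneg fun _ _ => by positivity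

theorem progressionSum_le (k d e n : ℕ) :
    progressionSum k d e n ≤
      ((Finset.Ico 1 n).filter (fun b => e ∣ b ∧ d ∣ n - b)).card * (n : ℝ) ^ k := by
  rw [← nsmul_eq_mul]
  refine Finset.sum_le_card_nsmul _ _ _ fun b hb => ?_
  simp only [Finset.mem_filter, Finset.mem_Ico] at hb
  have : (b : ℝ) ≤ n := by exact_mod_cast hb.1.2.le
  gcongr

theorem card_Ico_filter_dvd_le (d n : ℕ) :
    (((Finset.Ico 1 n).filter (fun b => d ∣ b)).card : ℝ) ≤ n / d := by
  refine le_trans ?_ (Nat.cast_div_le (m := n) (n := d))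
  rw [← Nat.Ioc_filter_dvd_card_eq_div]
  have : Finset.Ico 1 n ⊆ Finset.Ioc 0 n := by
    intro b hb
    simp only [Finset.mem_Ico, Finset.mem_Ioc] at *
    omega
  exact_mod_cast Finset.card_le_card (Finset.filter_subset_filter _ this)

theorem card_Ico_filter_dvd_sub_le (d n : ℕ) :
    (((Finset.Ico 1 n).filter (fun b => d ∣ n - b)).card : ℝ) ≤ n / d := by
  refine le_trans ?_ (card_Ico_filter_dvd_le d n)
  have : ((Finset.Ico 1 n).filter (fun b => d ∣ n - b)).card ≤
      ((Finset.Ico 1 n).filter (fun b => d ∣ b)).card := by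
    refine Finset.card_le_card_of_injOn (fun b => n - b) ?_ ?_
    · intro b hb
      simp only [Finset.coe_filter, Finset.mem_Ico, Set.mem_ofPred_eq] at *
      exact ⟨by omega, hb.2⟩
    · intro a ha b hb hab
      simp only [Finset.coe_filter, Finset.mem_Ico, Set.mem_ofPred_eq] at *
      omega
  exact_mod_cast this

/-- Bounds uniform in n, obtained by dropping one of the two divisibility conditions; they supply
the domination for the limit under the double sum. -/
theorem progressionSum_div_le (k d e n : ℕ) :
    progressionSum k d e n / (n : ℝ) ^ (k + 1) ≤ 1 / d ∧
      progressionSum k d e n / (n : ℝ) ^ (k + 1) ≤ 1 / e := by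
  rcases Nat.eq_zero_or_pos n with rfl | hn
  · simp [progressionSum]
  have hn' : (0 : ℝ) < n := by exact_mod_cast hn
  have key : ∀ x : ℝ, (((Finset.Ico 1 n).filter (fun b => e ∣ b ∧ d ∣ n - b)).card : ℝ) ≤ n / x →
      progressionSum k d e n / (n : ℝ) ^ (k + 1) ≤ 1 / x := by
    intro x hx
    rw [div_le_iff₀ (by positivity)]
    refine (progressionSum_le k d e n).trans ?_
    calc _ ≤ n / x * (n : ℝ) ^ k := by gcongr
      _ = _ := by ring
  constructor
  · refine key _ (le_trans ?_ (card_Ico_filter_dvd_sub_le d n))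
    exact_mod_cast Finset.card_le_card fun b hb => by
      rw [Finset.mem_filter] at hb ⊢
      exact ⟨hb.1, hb.2.2⟩
  · refine key _ (le_trans ?_ (card_Ico_filter_dvd_le e n))
    exact_mod_cast Finset.card_le_card fun b hb => by
      rw [Finset.mem_filter] at hb ⊢
      exact ⟨hb.1, hb.2.1⟩

/-- The limiting density attached to `progressionSum`. -/
noncomputable def progressionDensity (d e n : ℕ) : ℝ :=
  if d.gcd e ∣ n then 1 / (d.lcm e : ℝ) else 0

/-- By the Chinese remainder theorem, b ≡ n mod d and b ≡ 0 mod e are solvable together exactly when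
gcd(d, e) ∣ n, and then cut out one class modulo lcm(d, e). -/
theorem abs_progressionSum_sub_le {d e : ℕ} (hd : 0 < d) (he : 0 < e) (k : ℕ) {n : ℕ}
    (hn : 1 ≤ n) :
    |progressionSum k d e n - (n : ℝ) ^ (k + 1) / (k + 1) * progressionDensity d e n| ≤
      (d.lcm e : ℝ) ^ k + (n : ℝ) ^ k := by
  rw [progressionDensity]
  split_ifs with h
  · obtain ⟨r, hr1, hr2⟩ := Nat.chineseRemainder' (n := d) (m := e) (a := n) (b := 0)
      (((Nat.modEq_zero_iff_dvd).2 h))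
    have hset : (Finset.Ico 1 n).filter (fun b => e ∣ b ∧ d ∣ n - b) =
        (Finset.Ico 1 n).filter (fun b => b ≡ r [MOD d.lcm e]) := by
      refine Finset.filter_congr fun b hb => ?_
      rw [Finset.mem_Ico] at hb
      constructor
      · rintro ⟨h1, h2⟩
        refine Nat.mod_lcm ?_ ?_
        · exact ((Nat.modEq_iff_dvd' hb.2.le).2 h2).trans hr1.symm
        · exact ((Nat.modEq_zero_iff_dvd).2 h1).trans hr2.symm
      · intro h1
        constructor
        · exact (Nat.modEq_zero_iff_dvd).1 ((h1.of_dvd (Nat.dvd_lcm_right d e)).trans hr2)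
        · exact (Nat.modEq_iff_dvd' hb.2.le).1 ((h1.of_dvd (Nat.dvd_lcm_left d e)).trans hr1)
    have := abs_sum_pow_modEq_sub_le (Nat.lcm_pos hd he) r k hn
    rw [progressionSum, hset]
    convert this using 3
    rw [div_mul_div_comm, mul_one]
  · have : progressionSum k d e n = 0 := by
      rw [progressionSum, Finset.filter_false_of_mem, Finset.sum_empty]
      rintro b hb ⟨h1, h2⟩
      rw [Finset.mem_Ico] at hb
      apply h
      have := dvd_add ((Nat.gcd_dvd_left d e).trans h2) ((Nat.gcd_dvd_right d e).trans h1)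
      rwa [Nat.sub_add_cancel hb.2.le] at this
    rw [this]
    simp
    positivity

theorem tendsto_progressionSum {d e : ℕ} (hd : 0 < d) (he : 0 < e) (k : ℕ) :
    Tendsto (fun n : ℕ => progressionSum k d e n / (n : ℝ) ^ (k + 1) -
      progressionDensity d e n / (k + 1)) atTop (nhds 0) := by
  have hlim : Tendsto (fun n : ℕ => ((d.lcm e : ℝ) ^ k + 1) / (n : ℝ)) atTop (nhds 0) :=
    tendsto_const_div_atTop_nhds_zero_nat _
  refine squeeze_zero_norm' ?_ hlim
  filter_upwards [eventually_ge_atTop 1] with n hn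
  have hn' : (1 : ℝ) ≤ n := by exact_mod_cast hn
  have hn0 : (0 : ℝ) < n := by linarith
  have h := abs_progressionSum_sub_le hd he k hn
  have e1 : progressionSum k d e n / (n : ℝ) ^ (k + 1) - progressionDensity d e n / (k + 1) =
      (progressionSum k d e n - (n : ℝ) ^ (k + 1) / (k + 1) * progressionDensity d e n) /
        (n : ℝ) ^ (k + 1) := by
    field_simp
  rw [e1, Real.norm_eq_abs, abs_div, abs_of_pos (a := (n : ℝ) ^ (k + 1)) (by positivity),
    div_le_iff₀ (by positivity)]
  refine h.trans ?_
  have e2 : ((d.lcm e : ℝ) ^ k + 1) / (n : ℝ) * (n : ℝ) ^ (k + 1) =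
      (d.lcm e : ℝ) ^ k * (n : ℝ) ^ k + (n : ℝ) ^ k := by
    rw [pow_succ]
    field_simp
  rw [e2]
  have : (1 : ℝ) ≤ (n : ℝ) ^ k := one_le_pow₀ hn'
  have h0 : (0 : ℝ) ≤ (d.lcm e : ℝ) ^ k := by positivity
  nlinarith

theorem progressionDensity_nonneg (d e n : ℕ) : 0 ≤ progressionDensity d e n := by
  rw [progressionDensity]
  split_ifs <;> positivity

theorem progressionDensity_le {d e : ℕ} (hd : 0 < d) (he : 0 < e) (n : ℕ) :
    progressionDensity d e n ≤ 1 / d ∧ progressionDensity d e n ≤ 1 / e := by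
  have hd' : (0 : ℝ) < d := by exact_mod_cast hd
  have he' : (0 : ℝ) < e := by exact_mod_cast he
  have hl := Nat.lcm_pos hd he
  have h1 : (d : ℝ) ≤ d.lcm e := by exact_mod_cast Nat.le_of_dvd hl (Nat.dvd_lcm_left d e)
  have h2 : (e : ℝ) ≤ d.lcm e := by exact_mod_cast Nat.le_of_dvd hl (Nat.dvd_lcm_right d e)
  rw [progressionDensity]
  split_ifs
  · constructor
    · exact one_div_le_one_div_of_le hd' h1
    · exact one_div_le_one_div_of_le he' h2
  · constructor <;> positivity

/-! ### Double sums weighted by a function of the gcd -/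

/-- The zeta series `∑ 1 / n ^ m` at a natural number `m`. -/
noncomputable def zetaSeries (m : ℕ) : ℝ := ∑' n : ℕ, 1 / (n : ℝ) ^ m

theorem summable_zetaSeries {m : ℕ} (hm : 2 ≤ m) : Summable (fun n : ℕ => 1 / (n : ℝ) ^ m) :=
  Real.summable_one_div_nat_pow.2 hm

theorem zetaSeries_pos {m : ℕ} (hm : 2 ≤ m) : 0 < zetaSeries m :=
  (summable_zetaSeries hm).tsum_pos (fun _ => by positivity) 1 (by simp)

/-- The summand `d ^ (-a) e ^ (-b)` restricted to coprime pairs `(d, e)`. -/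
noncomputable def coprimeSummand (a b : ℕ) (p : ℕ × ℕ) : ℝ :=
  if p.1.Coprime p.2 then 1 / (p.1 : ℝ) ^ a * (1 / (p.2 : ℝ) ^ b) else 0

theorem summable_coprimeSummand {a b : ℕ} (ha : 2 ≤ a) (hb : 2 ≤ b) :
    Summable (coprimeSummand a b) := by
  refine Summable.of_nonneg_of_le (fun p => ?_) (fun p => ?_)
    ((summable_zetaSeries ha).mul_of_nonneg (summable_zetaSeries hb)
      (fun _ => by positivity) (fun _ => by positivity))
  · rw [coprimeSummand]
    split_ifs <;> positivity
  · rw [coprimeSummand]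
    split_ifs
    · exact le_rfl
    · positivity

/-- Every pair of positive integers is uniquely (g d, g e) with d, e coprime, and its gcd is g, so
the sum factors. Terms with a zero entry vanish because 1 / 0 = 0. -/
theorem tsum_gcd_weight {a b : ℕ} (ha : 2 ≤ a) (hb : 2 ≤ b) (w : ℕ → ℝ)
    (hw : Summable fun g : ℕ => w g / (g : ℝ) ^ (a + b)) :
    ∑' p : ℕ × ℕ, w (p.1.gcd p.2) * (1 / (p.1 : ℝ) ^ a * (1 / (p.2 : ℝ) ^ b)) =
      (∑' g : ℕ, w g / (g : ℝ) ^ (a + b)) * ∑' p, coprimeSummand a b p := by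
  have ha0 : a ≠ 0 := by omega
  have hb0 : b ≠ 0 := by omega
  rw [tsum_mul_tsum_of_summable_norm hw.norm (summable_coprimeSummand ha hb).norm]
  let S : Set (ℕ × ℕ × ℕ) := {x | x.1 ≠ 0 ∧ x.2.1.Coprime x.2.2}
  have hsupp : Function.support (fun x : ℕ × ℕ × ℕ =>
      w x.1 / (x.1 : ℝ) ^ (a + b) * coprimeSummand a b x.2) ⊆ S := by
    rintro ⟨g, p⟩ hx
    rw [Function.mem_support] at hx
    constructor
    · rintro rfl
      simp [ha0] at hx
    · by_contra h
      simp [coprimeSummand, h] at hx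
  rw [← tsum_subtype_eq_of_support_subset hsupp]
  let scale : S → ℕ × ℕ := fun x => (x.1.1 * x.1.2.1, x.1.1 * x.1.2.2)
  have hgcd : ∀ x : S, (scale x).1.gcd (scale x).2 = x.1.1 := by
    rintro ⟨⟨g, d, e⟩, hg, hde⟩
    have : d.gcd e = 1 := hde
    simp only [scale, Nat.gcd_mul_left, this, mul_one]
  have hinj : Function.Injective scale := by
    intro x y hxy
    have h1 := hgcd x
    rw [hxy, hgcd y] at h1
    obtain ⟨⟨g, d, e⟩, hg, hde⟩ := x
    obtain ⟨⟨g', d', e'⟩, hg', hde'⟩ := y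
    simp only at h1
    subst h1
    simp only [scale, Prod.mk.injEq] at hxy
    have hg0 : 0 < g' := Nat.pos_of_ne_zero hg'
    have h1 := Nat.eq_of_mul_eq_mul_left hg0 hxy.1
    have h2 := Nat.eq_of_mul_eq_mul_left hg0 hxy.2
    subst h1 h2
    rfl
  have hrange : Function.support (fun p : ℕ × ℕ =>
      w (p.1.gcd p.2) * (1 / (p.1 : ℝ) ^ a * (1 / (p.2 : ℝ) ^ b))) ⊆ Set.range scale := by
    rintro ⟨d, e⟩ hp
    rw [Function.mem_support] at hp
    have hd : d ≠ 0 := by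
      rintro rfl
      simp [ha0] at hp
    have hg : 0 < d.gcd e := Nat.gcd_pos_of_pos_left _ (Nat.pos_of_ne_zero hd)
    refine ⟨⟨(d.gcd e, d / d.gcd e, e / d.gcd e), hg.ne', Nat.coprime_div_gcd_div_gcd hg⟩, ?_⟩
    simp only [scale, Nat.mul_div_cancel' (Nat.gcd_dvd_left d e),
      Nat.mul_div_cancel' (Nat.gcd_dvd_right d e)]
  rw [← hinj.tsum_eq hrange]
  refine tsum_congr fun x => ?_
  rw [hgcd x]
  obtain ⟨⟨g, d, e⟩, hg, hde⟩ := x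
  simp only at hde
  simp only [scale, coprimeSummand, if_pos hde]
  push_cast
  rw [mul_pow, mul_pow, pow_add]
  simp only [mul_inv, div_eq_mul_inv]
  ring

/-- The case of constant weight 1, which evaluates the coprime sum as a quotient of zeta values. -/
theorem zetaSeries_mul {a b : ℕ} (ha : 2 ≤ a) (hb : 2 ≤ b) :
    zetaSeries a * zetaSeries b = zetaSeries (a + b) * ∑' p, coprimeSummand a b p := by
  have h := tsum_gcd_weight ha hb (fun _ => 1) (summable_zetaSeries (by omega))
  simp only [one_mul] at h
  rw [zetaSeries, zetaSeries, zetaSeries, ← h]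
  exact tsum_mul_tsum_of_summable_norm (summable_zetaSeries ha).norm (summable_zetaSeries hb).norm

/-- Since 1/lcm(d, e) = gcd(d, e)/(d e), the summand is a gcd weight, g if g ∣ n and 0 otherwise,
against d^(-2) e^(-(m+1)). The sum over g is then ∑ g^(1-(m+3)) = σ_{-(m+2)}(n). -/
theorem tsum_progressionDensity {m n : ℕ} (hm : 1 ≤ m) (hn : n ≠ 0) :
    ∑' p : ℕ × ℕ, 1 / (p.1 : ℝ) * (1 / (p.2 : ℝ) ^ m) * progressionDensity p.1 p.2 n =
      sigmaNeg (m + 2) n * (zetaSeries 2 * zetaSeries (m + 1) / zetaSeries (m + 3)) := by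
  have hzero : ∀ g ∉ n.divisors,
      (if g ∣ n then (g : ℝ) else 0) / (g : ℝ) ^ (2 + (m + 1)) = 0 := by
    intro g hg
    have : ¬ g ∣ n := fun h => hg (Nat.mem_divisors.2 ⟨h, hn⟩)
    simp [this]
  have h := tsum_gcd_weight (a := 2) (b := m + 1) le_rfl (by omega)
    (fun g => if g ∣ n then (g : ℝ) else 0) (summable_of_ne_finset_zero hzero)
  have hP := zetaSeries_mul (a := 2) (b := m + 1) le_rfl (by omega)
  have e3 : 2 + (m + 1) = m + 3 := by ring
  have hz := zetaSeries_pos (m := m + 3) (by omega)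
  rw [tsum_eq_sum hzero] at h
  have hsig : ∑ g ∈ n.divisors, (if g ∣ n then (g : ℝ) else 0) / (g : ℝ) ^ (2 + (m + 1)) =
      sigmaNeg (m + 2) n := by
    refine Finset.sum_congr rfl fun g hg => ?_
    have hg0 : (g : ℝ) ≠ 0 := by
      have := Nat.pos_of_mem_divisors hg
      positivity
    rw [if_pos (Nat.dvd_of_mem_divisors hg), e3, pow_succ]
    field_simp
  rw [hsig] at h
  rw [e3] at hP
  rw [hP, mul_div_cancel_left₀ _ hz.ne', ← h]
  refine tsum_congr fun ⟨d, e⟩ => ?_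
  simp only [progressionDensity]
  rcases Nat.eq_zero_or_pos d with rfl | hd
  · simp
  rcases Nat.eq_zero_or_pos e with rfl | he
  · simp [show m ≠ 0 by omega]
  split_ifs
  · have h1 : (d.gcd e : ℝ) * (d.lcm e : ℝ) = d * e := by exact_mod_cast Nat.gcd_mul_lcm d e
    have hl : (0 : ℝ) < d.lcm e := by exact_mod_cast Nat.lcm_pos hd he
    have hd' : (0 : ℝ) < d := by exact_mod_cast hd
    have he' : (0 : ℝ) < e := by exact_mod_cast he
    rw [pow_succ (e : ℝ) m]
    field_simp
    linarith
  · simp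

/-! ### Convolution with σ_{-1} and dominated convergence -/

/-- The summand `d ^ (-m)` restricted to the divisors `d` of `a`. -/
noncomputable def divisorSummand (m a d : ℕ) : ℝ := if d ∣ a then 1 / (d : ℝ) ^ m else 0

theorem hasSum_sigmaNeg (m : ℕ) {a : ℕ} (ha : a ≠ 0) :
    HasSum (divisorSummand m a) (sigmaNeg m a) := by
  have h : sigmaNeg m a = ∑ d ∈ a.divisors, divisorSummand m a d :=
    Finset.sum_congr rfl fun d hd => by
      rw [divisorSummand, if_pos (Nat.dvd_of_mem_divisors hd)]
  rw [h]
  apply hasSum_sum_of_ne_finset_zero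
  intro d hd
  have : ¬ d ∣ a := fun h => hd (Nat.mem_divisors.2 ⟨h, ha⟩)
  simp [divisorSummand, this]

theorem sum_antidiagonal_sigmaNeg (F : ℕ → ℝ) (hF : F 0 = 0) (n : ℕ) :
    ∑ p ∈ Finset.HasAntidiagonal.antidiagonal n, sigmaNeg 1 p.1 * F p.2 =
      ∑ b ∈ Finset.Ico 1 n, sigmaNeg 1 (n - b) * F b := by
  rw [← Finset.Nat.sum_antidiagonal_swap, Finset.Nat.sum_antidiagonal_eq_sum_range_succ_mk]
  symm
  apply Finset.sum_subset
  · intro b hb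
    simp only [Finset.mem_Ico, Finset.mem_range] at *
    omega
  · intro b hb hb'
    simp only [Finset.mem_Ico, Finset.mem_range] at *
    rcases Nat.eq_zero_or_pos b with rfl | h
    · simp [hF]
    · simp [show n - b = 0 by omega]

theorem hasSum_convolution_sigmaNeg (j m n : ℕ) :
    HasSum (fun p : ℕ × ℕ => 1 / (p.1 : ℝ) * (1 / (p.2 : ℝ) ^ m) * progressionSum j p.1 p.2 n)
      (∑ b ∈ Finset.Ico 1 n, sigmaNeg 1 (n - b) * ((b : ℝ) ^ j * sigmaNeg m b)) := by
  have h : ∀ b ∈ Finset.Ico 1 n, HasSum (fun p : ℕ × ℕ => 1 / (p.1 : ℝ) * (1 / (p.2 : ℝ) ^ m) *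
      if p.2 ∣ b ∧ p.1 ∣ n - b then (b : ℝ) ^ j else 0)
      (sigmaNeg 1 (n - b) * ((b : ℝ) ^ j * sigmaNeg m b)) := by
    intro b hb
    rw [Finset.mem_Ico] at hb
    have h1 := hasSum_sigmaNeg 1 (a := n - b) (by omega)
    have h2 := hasSum_sigmaNeg m (a := b) (by omega)
    have h3 := h1.mul h2 (summable_mul_of_summable_norm h1.summable.norm h2.summable.norm)
    have h4 := h3.mul_right ((b : ℝ) ^ j)
    rw [mul_assoc, mul_comm (sigmaNeg m b)] at h4
    refine Eq.mp (congrArg (fun f => HasSum f _) (funext fun p => ?_)) h4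
    by_cases c1 : p.2 ∣ b <;> by_cases c2 : p.1 ∣ n - b <;> simp [divisorSummand, c1, c2]
  refine Eq.mp (congrArg (fun f => HasSum f _) (funext fun p => ?_)) (hasSum_sum h)
  rw [progressionSum, Finset.sum_filter, Finset.mul_sum]

theorem hasSum_convolution_error (ε : ℕ → ℝ) (n : ℕ) :
    HasSum (fun d : ℕ => 1 / (d : ℝ) *
        ∑ b ∈ (Finset.Ico 1 n).filter (fun b => d ∣ n - b), ε b)
      (∑ b ∈ Finset.Ico 1 n, sigmaNeg 1 (n - b) * ε b) := by
  have h : ∀ b ∈ Finset.Ico 1 n, HasSum (fun d : ℕ => 1 / (d : ℝ) *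
      if d ∣ n - b then ε b else 0) (sigmaNeg 1 (n - b) * ε b) := by
    intro b hb
    rw [Finset.mem_Ico] at hb
    have h1 := hasSum_sigmaNeg 1 (a := n - b) (by omega)
    refine Eq.mp (congrArg (fun f => HasSum f _) (funext fun d => ?_)) (h1.mul_right (ε b))
    simp only [divisorSummand, pow_one]
    split_ifs <;> simp
  refine Eq.mp (congrArg (fun f => HasSum f _) (funext fun d => ?_)) (hasSum_sum h)
  rw [Finset.sum_filter, Finset.mul_sum]

/-- For fixed d the inner average is at most the Cesàro mean of ε, which tends to 0. Since at most n
/ d values of b satisfy d ∣ n - b, the d-th term is at most M / d², which is summable. -/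
theorem tendsto_convolution_error {ε : ℕ → ℝ} (hε : Tendsto ε atTop (nhds 0))
    (hpos : ∀ n, 0 ≤ ε n) :
    Tendsto (fun n : ℕ => (∑ b ∈ Finset.Ico 1 n, sigmaNeg 1 (n - b) * ε b) / (n : ℝ))
      atTop (nhds 0) := by
  obtain ⟨M, hM⟩ := hε.bddAbove_range
  have hM' : ∀ n, ε n ≤ M := fun n => hM ⟨n, rfl⟩
  have hM0 : 0 ≤ M := (hpos 0).trans (hM' 0)
  have hsum : Summable fun d : ℕ => M * (1 / (d : ℝ) ^ 2) :=
    (summable_zetaSeries le_rfl).mul_left M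
  have hnn : ∀ d n : ℕ, 0 ≤ ∑ b ∈ (Finset.Ico 1 n).filter (fun b => d ∣ n - b), ε b :=
    fun d n => Finset.sum_nonneg fun b _ => hpos b
  have key := tendsto_tsum_of_dominated_convergence (𝓕 := atTop)
    (f := fun (n d : ℕ) => 1 / (d : ℝ) *
      ∑ b ∈ (Finset.Ico 1 n).filter (fun b => d ∣ n - b), ε b / (n : ℝ))
    (g := fun _ => 0) hsum ?_ ?_
  · rw [tsum_zero] at key
    refine key.congr fun n => ?_
    have := (hasSum_convolution_error ε n).div_const (n : ℝ)
    rw [← this.tsum_eq]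
    refine tsum_congr fun d => ?_
    rw [← Finset.sum_div, mul_div_assoc]
  · intro d
    have hc := hε.cesaro
    have hc' := hc.const_mul (1 / (d : ℝ))
    rw [mul_zero] at hc'
    refine squeeze_zero (fun n => ?_) (fun n => ?_) hc'
    · rw [← Finset.sum_div]
      have := hnn d n
      positivity
    · rw [← Finset.sum_div]
      refine mul_le_mul_of_nonneg_left ?_ (by positivity)
      rw [div_eq_inv_mul]
      have : ∑ b ∈ (Finset.Ico 1 n).filter (fun b => d ∣ n - b), ε b ≤
          ∑ b ∈ Finset.range n, ε b := by
        refine Finset.sum_le_sum_of_subset_of_nonneg ?_ fun b _ _ => hpos b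
        intro b hb
        simp only [Finset.mem_filter, Finset.mem_Ico, Finset.mem_range] at *
        omega
      gcongr
  · filter_upwards [eventually_ge_atTop 1] with n hn d
    have hn' : (0 : ℝ) < n := by exact_mod_cast hn
    rw [← Finset.sum_div, Real.norm_eq_abs, abs_of_nonneg
      (mul_nonneg (by positivity) (div_nonneg (hnn d n) hn'.le))]
    have h1 : ∑ b ∈ (Finset.Ico 1 n).filter (fun b => d ∣ n - b), ε b ≤ n / d * M := by
      refine (Finset.sum_le_card_nsmul _ _ M fun b _ => hM' b).trans ?_
      rw [nsmul_eq_mul]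
      have := card_Ico_filter_dvd_sub_le d n
      gcongr
    have h2 : (∑ b ∈ (Finset.Ico 1 n).filter (fun b => d ∣ n - b), ε b) / n ≤ M * (1 / d) := by
      rw [div_le_iff₀ hn']
      refine h1.trans (le_of_eq ?_)
      ring
    calc _ ≤ 1 / (d : ℝ) * (M * (1 / d)) := by gcongr
      _ = _ := by
        rw [pow_two, ← one_div_mul_one_div]
        ring

/-- Geometric mean of the two bounds. With weight 1/(d e), as occurs for m = 1, neither bound alone
gives a summable double series; together they give (d e)^(-3/2). -/
theorem le_one_div_sqrt_mul_sqrt {x d e : ℝ} (hx : 0 ≤ x) (hd : 0 < d) (_he : 0 < e)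
    (h1 : x ≤ 1 / d) (h2 : x ≤ 1 / e) : x ≤ 1 / √d * (1 / √e) := by
  have h : x ≤ √(1 / d * (1 / e)) := by
    apply Real.le_sqrt_of_sq_le
    rw [pow_two]
    gcongr
  rwa [Real.sqrt_mul (by positivity), Real.sqrt_div zero_le_one, Real.sqrt_div zero_le_one,
    Real.sqrt_one] at h

theorem summable_one_div_mul_sqrt : Summable fun n : ℕ => 1 / (n : ℝ) * (1 / √(n : ℝ)) := by
  refine (Real.summable_one_div_nat_rpow (p := 3 / 2).2 (by norm_num)).congr fun n => ?_
  rcases Nat.eq_zero_or_pos n with rfl | hn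
  · norm_num
  have hn' : (0 : ℝ) < n := by exact_mod_cast hn
  rw [show (3 / 2 : ℝ) = 1 + 1 / 2 by norm_num, Real.rpow_add hn', Real.rpow_one,
    ← Real.sqrt_eq_rpow, one_div_mul_one_div]

theorem weight_mul_le {m : ℕ} (hm : 1 ≤ m) {x : ℝ} (d e : ℕ) (hx : 0 ≤ x)
    (h : 0 < d → 0 < e → x ≤ 1 / d ∧ x ≤ 1 / e) :
    1 / (d : ℝ) * (1 / (e : ℝ) ^ m) * x ≤
      1 / (d : ℝ) * (1 / √(d : ℝ)) * (1 / (e : ℝ) * (1 / √(e : ℝ))) := by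
  rcases Nat.eq_zero_or_pos d with rfl | hd
  · simp
  rcases Nat.eq_zero_or_pos e with rfl | he
  · simp [show m ≠ 0 by omega]
  have hd' : (0 : ℝ) < d := by exact_mod_cast hd
  have he' : (0 : ℝ) < e := by exact_mod_cast he
  have he1 : (1 : ℝ) ≤ e := by exact_mod_cast he
  have h1 := le_one_div_sqrt_mul_sqrt hx hd' he' (h hd he).1 (h hd he).2
  have h2 : 1 / (e : ℝ) ^ m ≤ 1 / e := by
    apply one_div_le_one_div_of_le he'
    exact le_self_pow₀ he1 (by omega)
  calc _ ≤ 1 / (d : ℝ) * (1 / (e : ℝ)) * (1 / √(d : ℝ) * (1 / √(e : ℝ))) := by gcongr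
    _ = _ := by ring

theorem summable_weight_bound : Summable fun p : ℕ × ℕ =>
    1 / (p.1 : ℝ) * (1 / √(p.1 : ℝ)) * (1 / (p.2 : ℝ) * (1 / √(p.2 : ℝ))) :=
  summable_one_div_mul_sqrt.mul_of_nonneg summable_one_div_mul_sqrt
    (fun _ => by positivity) (fun _ => by positivity)

theorem summable_progressionDensity {m : ℕ} (hm : 1 ≤ m) (n : ℕ) :
    Summable fun p : ℕ × ℕ =>
      1 / (p.1 : ℝ) * (1 / (p.2 : ℝ) ^ m) * progressionDensity p.1 p.2 n := by
  refine Summable.of_nonneg_of_le (fun p => ?_) (fun p => ?_) summable_weight_bound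
  · have := progressionDensity_nonneg p.1 p.2 n
    positivity
  · exact weight_mul_le hm _ _ (progressionDensity_nonneg _ _ _)
      fun hd he => progressionDensity_le hd he n

/-- The limit is taken on the difference from the density term, because that term itself oscillates
with n. -/
theorem tendsto_convolution_main (j : ℕ) {m : ℕ} (hm : 1 ≤ m) :
    Tendsto (fun n : ℕ =>
      (∑ b ∈ Finset.Ico 1 n, sigmaNeg 1 (n - b) * ((b : ℝ) ^ j * sigmaNeg m b)) /
        (n : ℝ) ^ (j + 1) -
      zetaSeries 2 * zetaSeries (m + 1) / zetaSeries (m + 3) / (j + 1) * sigmaNeg (m + 2) n)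
      atTop (nhds 0) := by
  have key := tendsto_tsum_of_dominated_convergence (𝓕 := atTop)
    (f := fun (n : ℕ) (p : ℕ × ℕ) => 1 / (p.1 : ℝ) * (1 / (p.2 : ℝ) ^ m) *
      (progressionSum j p.1 p.2 n / (n : ℝ) ^ (j + 1) - progressionDensity p.1 p.2 n / (j + 1)))
    (g := fun _ => 0) summable_weight_bound ?_ ?_
  · rw [tsum_zero] at key
    refine key.congr' ?_
    filter_upwards [eventually_ge_atTop 1] with n hn
    have h1 := (hasSum_convolution_sigmaNeg j m n).div_const ((n : ℝ) ^ (j + 1))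
    have h2 := (summable_progressionDensity hm n).hasSum.div_const ((j : ℝ) + 1)
    rw [tsum_progressionDensity hm (by omega)] at h2
    have h3 := (h1.sub h2).tsum_eq
    rw [show zetaSeries 2 * zetaSeries (m + 1) / zetaSeries (m + 3) / ((j : ℝ) + 1) *
      sigmaNeg (m + 2) n = sigmaNeg (m + 2) n *
        (zetaSeries 2 * zetaSeries (m + 1) / zetaSeries (m + 3)) / ((j : ℝ) + 1) by ring, ← h3]
    refine tsum_congr fun p => ?_
    ring
  · rintro ⟨d, e⟩
    rcases Nat.eq_zero_or_pos d with rfl | hd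
    · simp
    rcases Nat.eq_zero_or_pos e with rfl | he
    · simp [show m ≠ 0 by omega]
    simpa using (tendsto_progressionSum hd he j).const_mul (1 / (d : ℝ) * (1 / (e : ℝ) ^ m))
  · refine Eventually.of_forall fun n p => ?_
    obtain ⟨d, e⟩ := p
    rw [norm_mul, Real.norm_eq_abs, Real.norm_eq_abs, abs_of_nonneg (by positivity)]
    refine weight_mul_le hm _ _ (abs_nonneg _) fun hd he => ?_
    have h1 := progressionSum_div_le j d e n
    have h2 := progressionDensity_le hd he n
    have h3 : 0 ≤ progressionSum j d e n / (n : ℝ) ^ (j + 1) :=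
      div_nonneg (progressionSum_nonneg _ _ _ _) (by positivity)
    have h4 : 0 ≤ progressionDensity d e n / ((j : ℝ) + 1) :=
      div_nonneg (progressionDensity_nonneg _ _ _) (by positivity)
    have h5 : progressionDensity d e n / ((j : ℝ) + 1) ≤ progressionDensity d e n :=
      div_le_self (progressionDensity_nonneg _ _ _) (by linarith [(Nat.cast_nonneg j : (0:ℝ) ≤ j)])
    constructor <;> rw [abs_le] <;> constructor <;> linarith [h1.1, h1.2, h2.1, h2.2]

/-! ### Asymptotics of α(n, j + 1) -/

/-- The constants in the asymptotic formula for `α(n, j + 1)`. -/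
noncomputable def alphaConst : ℕ → ℝ
  | 0 => 1
  | j + 1 => alphaConst j *
      (zetaSeries 2 * zetaSeries (2 * j + 2) / zetaSeries (2 * j + 4) / (j + 1))

theorem alphaConst_pos (j : ℕ) : 0 < alphaConst j := by
  induction j with
  | zero => simp [alphaConst]
  | succ j ih =>
    rw [alphaConst]
    have h1 := zetaSeries_pos (m := 2) le_rfl
    have h2 := zetaSeries_pos (m := 2 * j + 2) (by omega)
    have h3 := zetaSeries_pos (m := 2 * j + 4) (by omega)
    positivity

theorem tendsto_dArcaisAlpha (j : ℕ) :
    Tendsto (fun n : ℕ => dArcaisAlpha n (j + 1) / (n : ℝ) ^ j -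
      alphaConst j * sigmaNeg (2 * j + 1) n) atTop (nhds 0) := by
  induction j with
  | zero => simp [dArcaisAlpha_one, alphaConst]
  | succ j ih =>
    -- The induction hypothesis says ε → 0. The main term raises the index of σ by 2, and the
    -- contribution of ε is o(n^(j+1)) because b^j ≤ n^j.
    set ε : ℕ → ℝ := fun n => dArcaisAlpha n (j + 1) / (n : ℝ) ^ j -
      alphaConst j * sigmaNeg (2 * j + 1) n with hε
    have hα : ∀ b, dArcaisAlpha b (j + 1) =
        alphaConst j * ((b : ℝ) ^ j * sigmaNeg (2 * j + 1) b) + (b : ℝ) ^ j * ε b := by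
      intro b
      rcases Nat.eq_zero_or_pos b with rfl | hb
      · simp [hε, dArcaisAlpha_zero_left]
      · have hb' : (0 : ℝ) < b := by exact_mod_cast hb
        simp only [hε]
        field_simp
        ring
    have hconv : ∀ n, dArcaisAlpha n (j + 1 + 1) =
        alphaConst j * (∑ b ∈ Finset.Ico 1 n,
          sigmaNeg 1 (n - b) * ((b : ℝ) ^ j * sigmaNeg (2 * j + 1) b)) +
        ∑ b ∈ Finset.Ico 1 n, sigmaNeg 1 (n - b) * ((b : ℝ) ^ j * ε b) := by
      intro n
      rw [dArcaisAlpha_succ, sum_antidiagonal_sigmaNeg (fun b => dArcaisAlpha b (j + 1))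
        (dArcaisAlpha_zero_left (by omega)),
        Finset.mul_sum, ← Finset.sum_add_distrib]
      refine Finset.sum_congr rfl fun b _ => ?_
      rw [hα]
      ring
    have herr : Tendsto (fun n : ℕ =>
        (∑ b ∈ Finset.Ico 1 n, sigmaNeg 1 (n - b) * ((b : ℝ) ^ j * ε b)) / (n : ℝ) ^ (j + 1))
        atTop (nhds 0) := by
      have h0 : Tendsto (fun n => |ε n|) atTop (nhds 0) := by simpa using ih.abs
      refine squeeze_zero_norm (fun n => ?_) (tendsto_convolution_error h0 fun n => abs_nonneg _)
      rcases Nat.eq_zero_or_pos n with rfl | hn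
      · simp
      have hn' : (0 : ℝ) < n := by exact_mod_cast hn
      rw [Real.norm_eq_abs, abs_div, abs_of_pos (a := (n : ℝ) ^ (j + 1)) (by positivity),
        div_le_div_iff₀ (by positivity) hn']
      have h1 : |∑ b ∈ Finset.Ico 1 n, sigmaNeg 1 (n - b) * ((b : ℝ) ^ j * ε b)| ≤
          (n : ℝ) ^ j * ∑ b ∈ Finset.Ico 1 n, sigmaNeg 1 (n - b) * |ε b| := by
        refine (Finset.abs_sum_le_sum_abs _ _).trans ?_
        rw [Finset.mul_sum]
        refine Finset.sum_le_sum fun b hb => ?_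
        rw [Finset.mem_Ico] at hb
        have hbn : (b : ℝ) ≤ n := by exact_mod_cast hb.2.le
        have hs := sigmaNeg_nonneg 1 (n - b)
        rw [abs_mul, abs_mul, abs_of_nonneg hs, abs_of_nonneg (a := (b : ℝ) ^ j) (by positivity)]
        calc _ ≤ sigmaNeg 1 (n - b) * ((n : ℝ) ^ j * |ε b|) := by gcongr
          _ = _ := by ring
      calc _ ≤ ((n : ℝ) ^ j * ∑ b ∈ Finset.Ico 1 n, sigmaNeg 1 (n - b) * |ε b|) * n := by gcongr
        _ = _ := by ring
    have hmain := ((tendsto_convolution_main j (m := 2 * j + 1) (by omega)).const_mul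
      (alphaConst j)).add herr
    rw [mul_zero, add_zero] at hmain
    refine hmain.congr fun n => ?_
    rw [hconv, alphaConst, show 2 * (j + 1) + 1 = 2 * j + 1 + 2 by ring]
    ring

/-! ### Euler products and extremal values of σ_{-m} -/

theorem sigmaNeg_eq_sigma_div (m n : ℕ) :
    sigmaNeg m n = (ArithmeticFunction.sigma m n : ℝ) / (n : ℝ) ^ m := by
  rw [sigmaNeg, ← Nat.sum_div_divisors n (fun d => 1 / (d : ℝ) ^ m),
    ArithmeticFunction.sigma_apply]
  push_cast
  rw [Finset.sum_div]
  refine Finset.sum_congr rfl fun d hd => ?_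
  have hd0 : (d : ℝ) ≠ 0 := by
    have := Nat.pos_of_mem_divisors hd
    positivity
  rw [Nat.cast_div (Nat.dvd_of_mem_divisors hd) hd0, div_pow, one_div_div]

theorem sigmaNeg_mul_of_coprime (m : ℕ) {a b : ℕ} (h : a.Coprime b) :
    sigmaNeg m (a * b) = sigmaNeg m a * sigmaNeg m b := by
  simp only [sigmaNeg_eq_sigma_div]
  rw [ArithmeticFunction.isMultiplicative_sigma.map_mul_of_coprime h]
  push_cast
  rw [mul_pow, div_mul_div_comm]

@[simp] theorem sigmaNeg_one_right (m : ℕ) : sigmaNeg m 1 = 1 := by simp [sigmaNeg]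

theorem one_div_pow_lt_one {x : ℝ} (hx : 1 < x) {m : ℕ} (hm : m ≠ 0) : (1 / x) ^ m < 1 :=
  pow_lt_one₀ (by positivity) ((div_lt_one (by linarith)).2 hx) hm

theorem sigmaNeg_prime_pow {m : ℕ} (hm : m ≠ 0) {p : ℕ} (hp : p.Prime) (v : ℕ) :
    sigmaNeg m (p ^ v) = (1 - (1 / (p : ℝ) ^ (v + 1)) ^ m) * (1 - (1 / (p : ℝ)) ^ m)⁻¹ := by
  have hp1 : (1 : ℝ) < p := by exact_mod_cast hp.one_lt
  have h1 := one_div_pow_lt_one hp1 hm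
  rw [sigmaNeg, Nat.sum_divisors_prime_pow hp]
  have h : ∀ i ∈ Finset.range (v + 1), 1 / ((p ^ i : ℕ) : ℝ) ^ m = ((1 / (p : ℝ)) ^ m) ^ i := by
    intro i _
    push_cast
    rw [one_div_pow, one_div_pow, ← pow_mul, ← pow_mul, mul_comm]
  rw [Finset.sum_congr rfl h, geom_sum_eq h1.ne, ← neg_div_neg_eq, neg_sub, neg_sub,
    div_eq_mul_inv]
  congr 2
  rw [one_div_pow, one_div_pow, one_div_pow, ← pow_mul, ← pow_mul, mul_comm]

/-- The completely multiplicative function `n ↦ n ^ (-m)`. -/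
noncomputable def invPowHom (m : ℕ) (hm : m ≠ 0) : ℕ →*₀ ℝ where
  toFun n := 1 / (n : ℝ) ^ m
  map_zero' := by simp [hm]
  map_one' := by simp
  map_mul' a b := by
    push_cast
    rw [mul_pow, one_div_mul_one_div]

theorem hasProd_zetaSeries {m : ℕ} (hm : 2 ≤ m) :
    HasProd (fun p : Nat.Primes => (1 - (1 / (p : ℝ)) ^ m)⁻¹) (zetaSeries m) := by
  have h := EulerProduct.eulerProduct_completely_multiplicative_hasProd
    (f := invPowHom m (by omega)) (summable_zetaSeries hm).norm
  simpa [invPowHom, zetaSeries] using h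

/-- The numerator of the Euler factor of ζ(m)/σ_{-m}(n) cancels against the geometric sum for
σ_{-m}(p^v), leaving one factor in p^(-(v+1)m), valid also when v = 0. -/
theorem hasProd_zetaSeries_div_sigmaNeg {m n : ℕ} (hm : 2 ≤ m) (hn : n ≠ 0) :
    HasProd (fun p : Nat.Primes => (1 - (1 / (p : ℝ) ^ (n.factorization p + 1)) ^ m)⁻¹)
      (zetaSeries m / sigmaNeg m n) := by
  have hm0 : m ≠ 0 := by omega
  have hfac : sigmaNeg m n = ∏ p ∈ n.primeFactors.subtype Nat.Prime,
      (1 - (1 / ((p : ℕ) : ℝ) ^ (n.factorization p + 1)) ^ m) * (1 - (1 / (p : ℝ)) ^ m)⁻¹ := by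
    rw [Finset.prod_subtype_of_mem (fun p : ℕ =>
      (1 - (1 / (p : ℝ) ^ (n.factorization p + 1)) ^ m) * (1 - (1 / (p : ℝ)) ^ m)⁻¹)
      (fun p hp => Nat.prime_of_mem_primeFactors hp),
      Nat.multiplicative_factorization (sigmaNeg m) (fun _ _ => sigmaNeg_mul_of_coprime m)
        (sigmaNeg_one_right m) hn, Finsupp.prod, Nat.support_factorization]
    exact Finset.prod_congr rfl fun p hp =>
      sigmaNeg_prime_pow hm0 (Nat.prime_of_mem_primeFactors hp) _
  have hne : ∀ p : Nat.Primes, 1 - (1 / ((p : ℕ) : ℝ)) ^ m ≠ 0 := by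
    intro p
    have hp1 : (1 : ℝ) < (p : ℕ) := by exact_mod_cast p.2.one_lt
    linarith [one_div_pow_lt_one hp1 hm0]
  have h1 : HasProd (fun p : Nat.Primes =>
      ((1 - (1 / ((p : ℕ) : ℝ) ^ (n.factorization p + 1)) ^ m) * (1 - (1 / (p : ℝ)) ^ m)⁻¹)⁻¹)
      (sigmaNeg m n)⁻¹ := by
    rw [hfac, ← Finset.prod_inv_distrib]
    apply hasProd_prod_of_ne_finset_one
    intro p hp
    have hp' : ¬ (p : ℕ) ∣ n := by
      intro h
      apply hp
      refine Finset.mem_subtype.2 ?_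
      exact Nat.mem_primeFactors.2 ⟨p.2, h, hn⟩
    rw [Nat.factorization_eq_zero_of_not_dvd hp', zero_add, pow_one, mul_inv_cancel₀ (hne p),
      inv_one]
  have h2 := (hasProd_zetaSeries hm).mul h1
  rw [div_eq_mul_inv]
  convert h2 using 2 with p
  rw [mul_inv, inv_inv, mul_comm, mul_assoc, mul_inv_cancel₀ (hne p), mul_one]

theorem inv_one_sub_pow_sq_le {x : ℝ} (hx0 : 0 ≤ x) (hx1 : x < 1) {t : ℕ} (ht : t ≠ 0) :
    (1 - x ^ (t + 2))⁻¹ * (1 - x ^ (t + 2))⁻¹ ≤ (1 - x ^ t)⁻¹ * (1 - x ^ (t + 4))⁻¹ := by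
  have h1 : x ^ t < 1 := pow_lt_one₀ hx0 hx1 ht
  have h2 : x ^ (t + 4) < 1 := pow_lt_one₀ hx0 hx1 (by omega)
  rw [← mul_inv, ← mul_inv]
  apply inv_anti₀ (mul_pos (by linarith) (by linarith))
  have h3 : 0 ≤ x ^ t := by positivity
  have e1 : x ^ (t + 2) = x ^ t * x ^ 2 := pow_add _ _ _
  have e2 : x ^ (t + 4) = x ^ t * x ^ 2 * x ^ 2 := by rw [pow_add]; ring
  rw [e1, e2]
  -- The difference (1 - x^(t+2))² - (1 - x^t)(1 - x^(t+4)) equals x^t (1 - x²)².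
  nlinarith [mul_nonneg h3 (sq_nonneg (1 - x ^ 2))]

/-- Factorwise comparison with x = p^(-(v+1)), v being the exponent of p in n; partial products pass
to the limit. -/
theorem zetaSeries_div_sigmaNeg_sq_le {t n : ℕ} (ht : 2 ≤ t) (hn : n ≠ 0) :
    zetaSeries (t + 2) / sigmaNeg (t + 2) n * (zetaSeries (t + 2) / sigmaNeg (t + 2) n) ≤
      zetaSeries t / sigmaNeg t n * (zetaSeries (t + 4) / sigmaNeg (t + 4) n) := by
  have h0 := hasProd_zetaSeries_div_sigmaNeg (m := t + 2) (by omega) hn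
  have h1 := h0.mul h0
  have h2 := (hasProd_zetaSeries_div_sigmaNeg ht hn).mul
    (hasProd_zetaSeries_div_sigmaNeg (m := t + 4) (by omega) hn)
  refine le_of_tendsto_of_tendsto' h1 h2 fun s => ?_
  refine Finset.prod_le_prod (fun p _ => mul_self_nonneg _) fun p _ => ?_
  have hp1 : (1 : ℝ) < ((p : ℕ) : ℝ) := by exact_mod_cast p.2.one_lt
  refine inv_one_sub_pow_sq_le (by positivity) ?_ (by omega)
  rw [div_lt_one (by positivity)]
  exact one_lt_pow₀ hp1 (by omega)

theorem zetaSeries_sq_le {t : ℕ} (ht : 2 ≤ t) :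
    zetaSeries (t + 2) ^ 2 ≤ zetaSeries t * zetaSeries (t + 4) := by
  simpa [pow_two] using zetaSeries_div_sigmaNeg_sq_le ht one_ne_zero

theorem sigmaNeg_le_zetaSeries {m : ℕ} (hm : 2 ≤ m) (n : ℕ) : sigmaNeg m n ≤ zetaSeries m :=
  (summable_zetaSeries hm).sum_le_tsum _ fun _ _ => by positivity

/-- All of 1, …, N divide N!, so along factorials σ_{-m} approaches ζ(m) for m ≥ 2 and diverges for
m = 1. -/
theorem sum_range_le_sigmaNeg_factorial (m N : ℕ) :
    ∑ i ∈ Finset.range N, 1 / ((i : ℝ) + 1) ^ m ≤ sigmaNeg m N ! := by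
  have h : ∑ i ∈ Finset.range N, 1 / ((i : ℝ) + 1) ^ m =
      ∑ d ∈ (Finset.range N).image Nat.succ, 1 / (d : ℝ) ^ m := by
    rw [Finset.sum_image (fun a _ b _ hab => Nat.succ_injective hab)]
    simp
  rw [h]
  refine Finset.sum_le_sum_of_subset_of_nonneg ?_ fun _ _ _ => by positivity
  intro d hd
  simp only [Finset.mem_image, Finset.mem_range] at hd
  obtain ⟨i, hi, rfl⟩ := hd
  exact Nat.mem_divisors.2 ⟨Nat.dvd_factorial (by omega) (by omega), Nat.factorial_ne_zero N⟩

theorem zetaSeries_eq_tsum_succ {m : ℕ} (hm : 2 ≤ m) :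
    zetaSeries m = ∑' i : ℕ, 1 / ((i : ℝ) + 1) ^ m := by
  rw [zetaSeries, (summable_zetaSeries hm).tsum_eq_zero_add]
  simp [show m ≠ 0 by omega]

theorem tendsto_sigmaNeg_factorial {m : ℕ} (hm : 2 ≤ m) :
    Tendsto (fun N : ℕ => sigmaNeg m N !) atTop (nhds (zetaSeries m)) := by
  have hs : Summable fun i : ℕ => 1 / ((i : ℝ) + 1) ^ m := by
    simpa using (summable_nat_add_iff 1).2 (summable_zetaSeries hm)
  have h := hs.hasSum.tendsto_sum_nat
  rw [← zetaSeries_eq_tsum_succ hm] at h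
  exact tendsto_of_tendsto_of_tendsto_of_le_of_le h tendsto_const_nhds
    (fun N => sum_range_le_sigmaNeg_factorial m N) fun N => sigmaNeg_le_zetaSeries hm _

theorem tendsto_sigmaNeg_one_factorial :
    Tendsto (fun N : ℕ => sigmaNeg 1 N !) atTop atTop := by
  refine tendsto_atTop_mono (fun N => ?_) Real.tendsto_sum_range_one_div_nat_succ_atTop
  simpa using sum_range_le_sigmaNeg_factorial 1 N

theorem one_le_zetaSeries {m : ℕ} (hm : 2 ≤ m) : 1 ≤ zetaSeries m :=
  (one_le_sigmaNeg m one_ne_zero).trans (sigmaNeg_le_zetaSeries hm 1)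

theorem zetaSeries_anti {a b : ℕ} (ha : 2 ≤ a) (hab : a ≤ b) : zetaSeries b ≤ zetaSeries a := by
  refine (summable_zetaSeries (ha.trans hab)).tsum_le_tsum (fun n => ?_) (summable_zetaSeries ha)
  rcases Nat.eq_zero_or_pos n with rfl | hn
  · simp [show a ≠ 0 by omega, show b ≠ 0 by omega]
  · have h1 : (1 : ℝ) ≤ n := by exact_mod_cast hn
    exact one_div_le_one_div_of_le (by positivity) (pow_le_pow_right₀ h1 hab)

theorem zetaSeries_two_lt : zetaSeries 2 < 2 := by
  rw [zetaSeries, hasSum_zeta_two.tsum_eq]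
  nlinarith [Real.pi_lt_d2, Real.pi_pos]

theorem zetaSeries_sub_one_le {m : ℕ} :
    zetaSeries (m + 2) - 1 ≤ (zetaSeries 2 - 1) / 2 ^ m := by
  have hs : ∀ a, 2 ≤ a → zetaSeries a - 1 = ∑' i : ℕ, 1 / ((i : ℝ) + 2) ^ a ∧
      Summable fun i : ℕ => 1 / ((i : ℝ) + 2) ^ a := by
    intro a ha
    have h := (summable_zetaSeries ha).sum_add_tsum_nat_add 2
    have h' := (summable_nat_add_iff 2).2 (summable_zetaSeries ha)
    simp only [Finset.sum_range_succ, Finset.sum_range_zero] at h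
    push_cast at h h'
    refine ⟨?_, h'⟩
    rw [zetaSeries, ← h]
    simp [show a ≠ 0 by omega]
  rw [(hs _ (by omega)).1, (hs 2 le_rfl).1, ← tsum_div_const]
  refine (hs _ (by omega)).2.tsum_le_tsum (fun i => ?_) ((hs 2 le_rfl).2.div_const _)
  rw [div_div]
  apply one_div_le_one_div_of_le (by positivity)
  rw [add_comm m 2, pow_add]
  gcongr
  linarith [(Nat.cast_nonneg i : (0 : ℝ) ≤ i)]

theorem zetaReal_natCast {m : ℕ} (hm : 2 ≤ m) : zetaReal (m : ℝ) = zetaSeries m := by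
  rw [zetaReal, Complex.ofReal_natCast, zeta_nat_eq_tsum_of_gt_one (by omega), zetaSeries,
    ← Complex.ofReal_re (∑' n : ℕ, 1 / (n : ℝ) ^ m), Complex.ofReal_tsum]
  push_cast
  rfl

/-! ### The quotient and its limit inferior -/

/-- The quotient `α(n, k)² / (α(n, k - 1) α(n, k + 1))` for `k = i + 2`. -/
noncomputable def alphaQuotient (i n : ℕ) : ℝ :=
  dArcaisAlpha n (i + 2) ^ 2 / (dArcaisAlpha n (i + 1) * dArcaisAlpha n (i + 3))

/-- The arithmetic part of the asymptotics of `alphaQuotient`. -/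
noncomputable def sigmaNegQuotient (i n : ℕ) : ℝ :=
  sigmaNeg (2 * i + 3) n ^ 2 / (sigmaNeg (2 * i + 1) n * sigmaNeg (2 * i + 5) n)

theorem alphaQuotient_nonneg (i n : ℕ) : 0 ≤ alphaQuotient i n :=
  div_nonneg (sq_nonneg _) (mul_nonneg (dArcaisAlpha_nonneg _ _) (dArcaisAlpha_nonneg _ _))

/-- The additive error becomes a relative one because σ_{-m}(n) ≥ 1. -/
theorem tendsto_dArcaisAlpha_div (j : ℕ) :
    Tendsto (fun n : ℕ => dArcaisAlpha n (j + 1) / (n : ℝ) ^ j / sigmaNeg (2 * j + 1) n)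
      atTop (nhds (alphaConst j)) := by
  rw [tendsto_iff_norm_sub_tendsto_zero]
  have h := (tendsto_dArcaisAlpha j).norm
  rw [norm_zero] at h
  refine squeeze_zero' (Eventually.of_forall fun n => norm_nonneg _) ?_ h
  filter_upwards [eventually_ge_atTop 1] with n hn
  have h1 := one_le_sigmaNeg (2 * j + 1) (n := n) (by omega)
  have h0 : 0 < sigmaNeg (2 * j + 1) n := by linarith
  rw [div_sub' h0.ne', norm_div, Real.norm_of_nonneg h0.le, mul_comm (sigmaNeg _ _)]
  exact div_le_self (norm_nonneg _) h1

theorem alphaQuotient_asymp (i : ℕ) : ∃ u : ℕ → ℝ,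
    Tendsto u atTop (nhds (alphaConst (i + 1) ^ 2 / (alphaConst i * alphaConst (i + 2)))) ∧
      ∀ᶠ n in atTop, alphaQuotient i n = sigmaNegQuotient i n * u n := by
  have hne : alphaConst i * alphaConst (i + 2) ≠ 0 :=
    (mul_pos (alphaConst_pos _) (alphaConst_pos _)).ne'
  refine ⟨_, ((tendsto_dArcaisAlpha_div (i + 1)).pow 2).div
    ((tendsto_dArcaisAlpha_div i).mul (tendsto_dArcaisAlpha_div (i + 2))) hne, ?_⟩
  filter_upwards [eventually_ge_atTop (i + 3)] with n hn
  have hn' : (0 : ℝ) < n := by exact_mod_cast (by omega : 0 < n)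
  have p1 := dArcaisAlpha_pos (n := n) (k := i + 1) (by omega) (by omega)
  have p3 := dArcaisAlpha_pos (n := n) (k := i + 3) (by omega) (by omega)
  have q : ∀ m, 0 < sigmaNeg m n := fun m =>
    lt_of_lt_of_le one_pos (one_le_sigmaNeg m (by omega))
  have q1 := q (2 * i + 1)
  have q2 := q (2 * i + 3)
  have q3 := q (2 * i + 5)
  simp only [alphaQuotient, sigmaNegQuotient, Pi.div_apply, show 2 * (i + 1) + 1 = 2 * i + 3 by ring,
    show 2 * (i + 2) + 1 = 2 * i + 5 by ring, show i + 1 + 1 = i + 2 by ring,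
    show i + 2 + 1 = i + 3 by ring]
  field_simp
  ring

theorem alphaConst_quotient (i : ℕ) :
    alphaConst (i + 1) ^ 2 / (alphaConst i * alphaConst (i + 2)) =
      ((i : ℝ) + 2) / (i + 1) *
        (zetaSeries (2 * i + 6) * zetaSeries (2 * i + 2) / zetaSeries (2 * i + 4) ^ 2) := by
  have h0 := alphaConst_pos i
  have z0 := zetaSeries_pos (m := 2) le_rfl
  have z1 := zetaSeries_pos (m := 2 * i + 2) (by omega)
  have z2 := zetaSeries_pos (m := 2 * i + 4) (by omega)
  have z3 := zetaSeries_pos (m := 2 * i + 6) (by omega)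
  simp only [alphaConst, show 2 * (i + 1) + 2 = 2 * i + 4 by ring,
    show 2 * (i + 1) + 4 = 2 * i + 6 by ring]
  push_cast
  rw [show (i : ℝ) + 1 + 1 = i + 2 by ring]
  field_simp

theorem alphaLimit_eq {i : ℕ} (hi : 1 ≤ i) :
    alphaLimit (i + 2) = alphaConst (i + 1) ^ 2 / (alphaConst i * alphaConst (i + 2)) *
      (zetaSeries (2 * i + 3) ^ 2 / (zetaSeries (2 * i + 1) * zetaSeries (2 * i + 5))) := by
  rw [alphaConst_quotient, alphaLimit]
  have e1 : 2 * ((i + 2 : ℕ) : ℝ) + 2 = ((2 * i + 6 : ℕ) : ℝ) := by push_cast; ring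
  have e2 : 2 * ((i + 2 : ℕ) : ℝ) - 2 = ((2 * i + 2 : ℕ) : ℝ) := by push_cast; ring
  have e3 : 2 * ((i + 2 : ℕ) : ℝ) = ((2 * i + 4 : ℕ) : ℝ) := by push_cast; ring
  have e4 : 2 * ((i + 2 : ℕ) : ℝ) - 1 = ((2 * i + 3 : ℕ) : ℝ) := by push_cast; ring
  have e5 : 2 * ((i + 2 : ℕ) : ℝ) - 3 = ((2 * i + 1 : ℕ) : ℝ) := by push_cast; ring
  have e6 : 2 * ((i + 2 : ℕ) : ℝ) + 1 = ((2 * i + 5 : ℕ) : ℝ) := by push_cast; ring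
  rw [e1, e2, e4, e5, e6, e3]
  rw [zetaReal_natCast (by omega), zetaReal_natCast (by omega), zetaReal_natCast (by omega),
    zetaReal_natCast (by omega), zetaReal_natCast (by omega), zetaReal_natCast (by omega)]
  push_cast
  rw [show (i : ℝ) + 2 - 1 = i + 1 by ring]

/-- This holds for each n ≠ 0, not only in the limit. The assumption `1 ≤ i` keeps the smallest
exponent 2i + 1 in the range where the zeta series converges. -/
theorem le_sigmaNegQuotient {i n : ℕ} (hi : 1 ≤ i) (hn : n ≠ 0) :
    zetaSeries (2 * i + 3) ^ 2 / (zetaSeries (2 * i + 1) * zetaSeries (2 * i + 5)) ≤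
      sigmaNegQuotient i n := by
  have h := zetaSeries_div_sigmaNeg_sq_le (t := 2 * i + 1) (by omega) hn
  have q : ∀ m, 0 < sigmaNeg m n := fun m => lt_of_lt_of_le one_pos (one_le_sigmaNeg m hn)
  have q1 := q (2 * i + 1)
  have q2 := q (2 * i + 3)
  have q3 := q (2 * i + 5)
  have z1 := zetaSeries_pos (m := 2 * i + 1) (by omega)
  have z3 := zetaSeries_pos (m := 2 * i + 5) (by omega)
  rw [sigmaNegQuotient, div_le_div_iff₀ (by positivity) (by positivity)]
  simp only [show 2 * i + 1 + 2 = 2 * i + 3 by ring, show 2 * i + 1 + 4 = 2 * i + 5 by ring] at h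
  rw [div_mul_div_comm, div_mul_div_comm, div_le_div_iff₀ (by positivity) (by positivity)] at h
  linarith

theorem tendsto_sigmaNegQuotient_factorial {i : ℕ} (hi : 1 ≤ i) :
    Tendsto (fun N : ℕ => sigmaNegQuotient i N !) atTop
      (nhds (zetaSeries (2 * i + 3) ^ 2 / (zetaSeries (2 * i + 1) * zetaSeries (2 * i + 5)))) := by
  have z1 := zetaSeries_pos (m := 2 * i + 1) (by omega)
  have z3 := zetaSeries_pos (m := 2 * i + 5) (by omega)
  exact ((tendsto_sigmaNeg_factorial (by omega)).pow 2).div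
    ((tendsto_sigmaNeg_factorial (by omega)).mul (tendsto_sigmaNeg_factorial (by omega)))
    (mul_pos z1 z3).ne'

theorem tendsto_sigmaNegQuotient_zero_factorial :
    Tendsto (fun N : ℕ => sigmaNegQuotient 0 N !) atTop (nhds 0) := by
  have h : Tendsto (fun N : ℕ => zetaSeries 3 ^ 2 / sigmaNeg 1 N !) atTop (nhds 0) :=
    tendsto_sigmaNeg_one_factorial.const_div_atTop _
  refine squeeze_zero (fun N => ?_) (fun N => ?_) h
  · exact div_nonneg (sq_nonneg _) (mul_nonneg (sigmaNeg_nonneg _ _) (sigmaNeg_nonneg _ _))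
  · have h1 := one_le_sigmaNeg 1 (Nat.factorial_ne_zero N)
    have h5 := one_le_sigmaNeg 5 (Nat.factorial_ne_zero N)
    have h3 := sigmaNeg_le_zetaSeries (m := 3) (by omega) N !
    have h30 := sigmaNeg_nonneg 3 N !
    simp only [sigmaNegQuotient, mul_zero, zero_add]
    have : sigmaNeg 1 N ! ≤ sigmaNeg 1 N ! * sigmaNeg 5 N ! :=
      le_mul_of_one_le_right (by linarith) h5
    gcongr

theorem tendsto_factorial_atTop : Tendsto Nat.factorial atTop atTop :=
  tendsto_atTop_mono Nat.self_le_factorial tendsto_id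

theorem tendsto_alphaQuotient_factorial {i : ℕ} {g : ℝ}
    (hg : Tendsto (fun N : ℕ => sigmaNegQuotient i N !) atTop (nhds g)) :
    Tendsto (fun N : ℕ => alphaQuotient i N !) atTop
      (nhds (alphaConst (i + 1) ^ 2 / (alphaConst i * alphaConst (i + 2)) * g)) := by
  obtain ⟨u, hu, he⟩ := alphaQuotient_asymp i
  rw [mul_comm]
  refine (hg.mul (hu.comp tendsto_factorial_atTop)).congr' ?_
  filter_upwards [tendsto_factorial_atTop.eventually he] with N hN
  exact hN.symm

theorem liminf_coe_le_of_tendsto_comp {r : ℕ → ℝ} {ψ : ℕ → ℕ} (hmap : Tendsto ψ atTop atTop) {c : ℝ}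
    (h : Tendsto (fun N => r (ψ N)) atTop (nhds c)) :
    liminf (fun n => (r n : EReal)) atTop ≤ c := by
  have h1 : Tendsto (fun N => (r (ψ N) : EReal)) atTop (nhds c) :=
    (continuous_coe_real_ereal.tendsto c).comp h
  rw [← h1.liminf_eq]
  exact liminf_le_liminf_of_le hmap

theorem liminf_alphaQuotient_zero :
    liminf (fun n => (alphaQuotient 0 n : EReal)) atTop = 0 := by
  apply le_antisymm
  · have h := tendsto_alphaQuotient_factorial tendsto_sigmaNegQuotient_zero_factorial
    rw [mul_zero] at h
    exact_mod_cast liminf_coe_le_of_tendsto_comp tendsto_factorial_atTop h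
  · refine le_liminf_of_le (h := Eventually.of_forall fun n => ?_)
    exact_mod_cast alphaQuotient_nonneg 0 n

theorem liminf_alphaQuotient {i : ℕ} (hi : 1 ≤ i) :
    liminf (fun n => (alphaQuotient i n : EReal)) atTop = (alphaLimit (i + 2) : EReal) := by
  rw [alphaLimit_eq hi]
  apply le_antisymm
  · exact liminf_coe_le_of_tendsto_comp tendsto_factorial_atTop
      -- The subsequence N! gives the upper bound; the pointwise bound on the arithmetic part gives
      -- the lower one.
      (tendsto_alphaQuotient_factorial (tendsto_sigmaNegQuotient_factorial hi))
  · obtain ⟨u, hu, he⟩ := alphaQuotient_asymp i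
    set g := zetaSeries (2 * i + 3) ^ 2 / (zetaSeries (2 * i + 1) * zetaSeries (2 * i + 5))
    have hpos : 0 < alphaConst (i + 1) ^ 2 / (alphaConst i * alphaConst (i + 2)) := by
      have h1 := alphaConst_pos i
      have h2 := alphaConst_pos (i + 1)
      have h3 := alphaConst_pos (i + 2)
      positivity
    have h1 : Tendsto (fun n => ((u n * g : ℝ) : EReal)) atTop (nhds _) :=
      (continuous_coe_real_ereal.tendsto _).comp (hu.mul_const g)
    rw [← h1.liminf_eq]
    refine liminf_le_liminf ?_
    filter_upwards [he, hu.eventually (lt_mem_nhds hpos), eventually_ge_atTop 1] with n hn hun h1n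
    rw [hn, mul_comm]
    have := le_sigmaNegQuotient hi (n := n) (by omega)
    exact_mod_cast mul_le_mul_of_nonneg_right this hun.le

/-! ### The limit exceeds 1, and the Heim–Neuhauser inequality -/

/-- Log-convexity makes the even zeta ratio at least 1, and ζ(2k-1)² ≥ ζ(2k+1) bounds the odd ratio
below by 1/ζ(2k-3). What remains is ζ(2k-3) < k/(k-1), which follows from ζ(2k-3) - 1 ≤ (ζ(2) -
1)/2^(2k-5) and ζ(2) < 2. Here k = j + 3. -/
theorem one_lt_alphaLimit {i : ℕ} (hi : 1 ≤ i) : 1 < alphaLimit (i + 2) := by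
  rw [alphaLimit_eq hi, alphaConst_quotient]
  obtain ⟨j, rfl⟩ := Nat.exists_eq_add_of_le' hi
  have z1 := zetaSeries_pos (m := 2 * (j + 1) + 1) (by omega)
  have z3 := zetaSeries_pos (m := 2 * (j + 1) + 5) (by omega)
  have z4 := zetaSeries_pos (m := 2 * (j + 1) + 4) (by omega)
  have h1 : 1 ≤ zetaSeries (2 * (j + 1) + 6) * zetaSeries (2 * (j + 1) + 2) /
      zetaSeries (2 * (j + 1) + 4) ^ 2 := by
    have h := zetaSeries_sq_le (t := 2 * (j + 1) + 2) (by omega)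
    rw [show 2 * (j + 1) + 2 + 2 = 2 * (j + 1) + 4 by ring,
      show 2 * (j + 1) + 2 + 4 = 2 * (j + 1) + 6 by ring] at h
    rw [one_le_div (by positivity)]
    linarith
  have h2 : 1 / zetaSeries (2 * (j + 1) + 1) ≤ zetaSeries (2 * (j + 1) + 3) ^ 2 /
      (zetaSeries (2 * (j + 1) + 1) * zetaSeries (2 * (j + 1) + 5)) := by
    rw [div_le_div_iff₀ z1 (by positivity), one_mul, mul_comm (zetaSeries _)]
    have a1 := zetaSeries_anti (a := 2 * (j + 1) + 3) (b := 2 * (j + 1) + 5) (by omega) (by omega)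
    have a2 := one_le_zetaSeries (m := 2 * (j + 1) + 3) (by omega)
    gcongr
    nlinarith
  have h3 : zetaSeries (2 * (j + 1) + 1) < ((j : ℝ) + 3) / (j + 2) := by
    have b1 := zetaSeries_sub_one_le (m := 2 * j + 1)
    have b2 := zetaSeries_two_lt
    have b3 : ((j : ℝ) + 2) ≤ 2 ^ (2 * j + 1) := by
      have : j + 2 ≤ 2 ^ (2 * j + 1) := by
        have := Nat.lt_two_pow_self (n := 2 * j + 1)
        omega
      exact_mod_cast this
    have b4 : (zetaSeries 2 - 1) / 2 ^ (2 * j + 1) < 1 / ((j : ℝ) + 2) := by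
      rw [div_lt_div_iff₀ (by positivity) (by positivity)]
      nlinarith [(Nat.cast_nonneg j : (0 : ℝ) ≤ j)]
    have b5 : ((j : ℝ) + 3) / (j + 2) = 1 + 1 / (j + 2) := by
      field_simp
      ring
    rw [show 2 * (j + 1) + 1 = 2 * j + 1 + 2 by ring]
    linarith
  push_cast
  have h4 : 1 < ((j : ℝ) + 3) / (j + 2) * (1 / zetaSeries (2 * (j + 1) + 1)) := by
    rw [mul_one_div]
    exact (one_lt_div z1).2 h3
  rw [show (j : ℝ) + 1 + 2 = j + 3 by ring, show (j : ℝ) + 1 + 1 = j + 2 by ring]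
  calc (1 : ℝ) < ((j : ℝ) + 3) / (j + 2) * 1 * (1 / zetaSeries (2 * (j + 1) + 1)) := by
        rwa [mul_one]
    _ ≤ _ := by gcongr

/-- Clearing the factorials in A(2, n, k) = n! α(n, k) / k! turns the comparison into a threshold
k/(k+1) for the quotient, with k = i + 2; `hn` makes all three values of α positive. -/
theorem heimNeuhauser_iff {i n : ℕ} (hn : i + 3 ≤ n) :
    HeimNeuhauser n (i + 2) ↔ ((i : ℝ) + 2) / (i + 3) ≤ alphaQuotient i n := by
  have hA : ∀ k, dArcais n k = dArcaisAlpha n k * (n ! : ℝ) / (k ! : ℝ) := by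
    intro k
    have h1 : (n ! : ℝ) ≠ 0 := by positivity
    have h2 : (k ! : ℝ) ≠ 0 := by positivity
    rw [dArcaisAlpha]
    field_simp
  have p1 := dArcaisAlpha_pos (n := n) (k := i + 1) (by omega) (by omega)
  have p2 := dArcaisAlpha_pos (n := n) (k := i + 2) (by omega) (by omega)
  have p3 := dArcaisAlpha_pos (n := n) (k := i + 3) (by omega) (by omega)
  have f0 : (0 : ℝ) < (n ! : ℝ) := by positivity
  have f1 : (0 : ℝ) < ((i + 1)! : ℝ) := by positivity
  have f2 : (((i + 2)! : ℕ) : ℝ) = (i + 2) * ((i + 1)! : ℝ) := by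
    rw [Nat.factorial_succ (i + 1)]
    push_cast
    ring
  have f3 : (((i + 3)! : ℕ) : ℝ) = (i + 3) * ((i + 2) * ((i + 1)! : ℝ)) := by
    rw [Nat.factorial_succ (i + 2), ← f2]
    push_cast
    ring
  have e1 : dArcais n (i + 2) / dArcais n (i + 1) =
      dArcaisAlpha n (i + 2) / ((i + 2) * dArcaisAlpha n (i + 1)) := by
    rw [hA, hA, f2]
    field_simp
  have e2 : dArcais n (i + 3) / dArcais n (i + 2) =
      dArcaisAlpha n (i + 3) / ((i + 3) * dArcaisAlpha n (i + 2)) := by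
    rw [hA, hA, f2, f3]
    field_simp
  rw [HeimNeuhauser, show i + 2 - 1 = i + 1 by omega, show i + 2 + 1 = i + 3 by omega, ge_iff_le,
    e1, e2, alphaQuotient, div_le_div_iff₀ (by positivity) (by positivity),
    div_le_div_iff₀ (by positivity) (by positivity)]
  constructor <;> intro h <;> linarith

theorem infinite_not_heimNeuhauser_two : {n : ℕ | ¬ HeimNeuhauser n 2}.Infinite := by
  have h := tendsto_alphaQuotient_factorial tendsto_sigmaNegQuotient_zero_factorial
  rw [mul_zero] at h
  rw [← Nat.frequently_atTop_iff_infinite]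
  refine tendsto_factorial_atTop.frequently (Eventually.frequently ?_)
  filter_upwards [h.eventually (gt_mem_nhds (by norm_num : (0 : ℝ) < 2 / 3)),
    tendsto_factorial_atTop.eventually (eventually_ge_atTop 3)] with N h1 h2
  rw [heimNeuhauser_iff (i := 0) (by simpa using h2)]
  push_cast
  norm_num at h1 ⊢
  exact h1

theorem eventually_heimNeuhauser {i : ℕ} (hi : 1 ≤ i) :
    ∀ᶠ n : ℕ in atTop, HeimNeuhauser n (i + 2) := by
  have h : (1 : EReal) < liminf (fun n => (alphaQuotient i n : EReal)) atTop := by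
    rw [liminf_alphaQuotient hi]
    exact_mod_cast one_lt_alphaLimit hi
  filter_upwards [eventually_lt_of_lt_liminf h, eventually_ge_atTop (i + 3)] with n h1 h2
  rw [heimNeuhauser_iff h2]
  have h3 : 1 < alphaQuotient i n := by exact_mod_cast h1
  refine le_trans ?_ h3.le
  rw [div_le_one (by positivity)]
  linarith

theorem corollary2p3 :
    -- the quotients below are well defined for `n ≥ k + 1`
    (∀ n k : ℕ, 1 ≤ k → k ≤ n → 0 < dArcaisAlpha n k) ∧
    -- the case `k = 2`
    liminf (fun n : ℕ =>
        ((dArcaisAlpha n 2 ^ 2 / (dArcaisAlpha n 1 * dArcaisAlpha n 3) : ℝ) : EReal)) atTop = 0 ∧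
    {n : ℕ | ¬ HeimNeuhauser n 2}.Infinite ∧
    -- the case `k ≥ 3`
    ∀ k : ℕ, 3 ≤ k →
      liminf (fun n : ℕ =>
          ((dArcaisAlpha n k ^ 2 / (dArcaisAlpha n (k - 1) * dArcaisAlpha n (k + 1)) : ℝ) : EReal))
        atTop = ((alphaLimit k : ℝ) : EReal) ∧
      1 < alphaLimit k ∧
      ∀ᶠ n : ℕ in atTop, HeimNeuhauser n k := by
  refine ⟨fun n k => dArcaisAlpha_pos, liminf_alphaQuotient_zero, infinite_not_heimNeuhauser_two,
    fun k hk => ?_⟩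
  obtain ⟨i, rfl⟩ : ∃ i, k = i + 2 := ⟨k - 2, by omega⟩
  have hi : 1 ≤ i := by omega
  exact ⟨liminf_alphaQuotient hi, one_lt_alphaLimit hi, eventually_heimNeuhauser hi⟩
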